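/- Let $\mathcal X\subset\mathbb R^d$ be compact, $\psi_0:\mathcal X\to\mathbb R$ continuous, and let $\hat Q_0,\hat Q_1$ be the empirical distributions of two non-empty finite training sequences in $\mathcal X$. For $\eta>0$ and $i=0,1$ let $\mathcal P_i^\eta$ be the set of all Borel probability measures $P$ on $\mathcal X$ with $|E_P[\psi_0]-E_{\hat Q_i}[\psi_0]|\le\eta$, and suppose that $\eta<\tfrac12\big(E_{\hat Q_1}[\psi_0]-E_{\hat Q_0}[\psi_0]\big)$. Let $\alpha\in(0,1]$, let $c$ be a constant with $c\ge\max_{x,x'\in\mathcal X}|\psi_0(x)-\psi_0(x')|$ (for instance this maximum), let $\gamma_n=\sqrt{-c^2\ln\alpha/(2n)}$, and consider, for i.i.d. samples $x^n=(x_1,\dots,x_n)$, the test $$\phi(x^n)=\begin{cases}1,&\frac1n\sum_{i=1}^n\psi_0(x_i)\ge E_{\hat Q_0}[\psi_0]+\eta+\gamma_n,\\ 0,&\text{otherwise,}\end{cases}$$ where $\phi(x^n)$ is the probability of accepting $H_1$. Then the following hold, with $\log 0=-\infty$. 1) For every $n\ge1$, $$\sup_{P_0\in\mathcal P_0^\eta}E_{P_0}[\phi(x^n)]=\sup_{P_0\in\mathcal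 P_0^\eta}P_0\Big(\tfrac1n\sum_{i=1}^n\psi_0(x_i)\ge E_{\hat Q_0}[\psi_0]+\eta+\gamma_n\Big)\le\alpha .$$ 2) For every $P_1\in\mathcal P_1^\eta$ the limits below exist in $[0,\infty]$, and $$\inf_{P_1\in\mathcal P_1^\eta}\lim_{n\to\infty}-\tfrac1n\log E_{P_1}[1-\phi(x^n)]=\inf_{P_1\in\mathcal P_1^\eta}\lim_{n\to\infty}-\tfrac1n\log P_1\Big(\tfrac1n\sum_{i=1}^n\psi_0(x_i)<E_{\hat Q_0}[\psi_0]+\eta+\gamma_n\Big)=\inf_{P_0\in\mathcal P_0^\eta,\,P_1\in\mathcal P_1^\eta}D(P_0\|P_1).$$ 3) If $\alpha<1$, the test is asymptotically optimal: its worst-case type-II error exponent equals $$\sup_{\phi'}\ \inf_{P_1\in\mathcal P_1^\eta}\ \limsup_{n\to\infty}-\tfrac1n\log E_{P_1}[1-\phi'(x^n)],$$ where the supremum is over all sequences of measurable batch tests $\phi':\mathcal X^n\to[0,1]$, $n\ge 1$, with $\sup_{P_0\in\mathcal P_0^\eta}E_{P_0}[\phi'(x^n)]\le\alpha$ for every $n\ge1$.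 The same three assertions hold under the same hypotheses if, for both $i=0,1$, $\mathcal P_i^\eta$ is instead defined by the one-sided constraint $E_P[\psi_0]-E_{\hat Q_i}[\psi_0]\le\eta$. -/

import Mathlib

open MeasureTheory Filter Topology
open scoped ENNReal

noncomputable section

/-- Empirical distribution `(1/m) ∑ⱼ δ_{xⱼ}` of a training sequence. -/
def empiricalMeasure {S : Type*} [MeasurableSpace S] {m : ℕ} (x : Fin m → S) : Measure S :=
  (m : ℝ≥0∞)⁻¹ • ∑ j, Measure.dirac (x j)

/-- Moment-constrained uncertainty set of radius `η` around the nominal moment `q`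
(one moment function): all Borel probability measures with `|E_P[ψ] - q| ≤ η`. -/
def momentSet {S : Type*} [MeasurableSpace S] (ψ : S → ℝ) (η q : ℝ) :
    Set (ProbabilityMeasure S) :=
  {P | |(∫ x, ψ x ∂(P : Measure S)) - q| ≤ η}

/-- The one-sided variant: all Borel probability measures with `E_P[ψ] - q ≤ η`. -/
def oneSidedMomentSet {S : Type*} [MeasurableSpace S] (ψ : S → ℝ) (η q : ℝ) :
    Set (ProbabilityMeasure S) :=
  {P | (∫ x, ψ x ∂(P : Measure S)) - q ≤ η}

/-- Law of `n` i.i.d. samples from `P`. -/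
def iidLaw {S : Type*} [MeasurableSpace S] (P : ProbabilityMeasure S) (n : ℕ) :
    Measure (Fin n → S) :=
  Measure.pi fun _ => (P : Measure S)

/-- A (randomized) batch test, for every sample size `n`: a measurable `φₙ : Sⁿ → [0,1]`;
`φₙ(x)` is the probability of accepting `H₁`. -/
structure BatchTest (S : Type*) [MeasurableSpace S] where
  /-- probability of accepting `H₁` -/
  prob : ∀ n : ℕ, (Fin n → S) → ℝ
  measurable_prob : ∀ n, Measurable (prob n)
  prob_mem : ∀ n x, prob n x ∈ Set.Icc (0 : ℝ) 1

/-- The sample mean `(1/n) ∑ᵢ ψ(xᵢ)`. -/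
def sampleMean {S : Type*} (ψ : S → ℝ) {n : ℕ} (x : Fin n → S) : ℝ :=
  (1 / (n : ℝ)) * ∑ i, ψ (x i)

open Classical in
/-- The test that accepts `H₁` iff the sample mean of `ψ` is at least `τ n`. -/
def thresholdTest {S : Type*} [MeasurableSpace S] (ψ : S → ℝ) (hψ : Measurable ψ)
    (τ : ℕ → ℝ) : BatchTest S where
  prob n x := if τ n ≤ sampleMean ψ x then 1 else 0
  measurable_prob n := by
    refine Measurable.ite ?_ measurable_const measurable_const
    refine measurableSet_le measurable_const ?_
    unfold sampleMean
    fun_prop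
  prob_mem n x := by
    split_ifs <;> simp

namespace BatchTest

variable {S : Type*} [MeasurableSpace S]

/-- Worst-case type-I error `sup_{P₀} E_{P₀}[φ(xⁿ)]` at sample size `n`. -/
def worstTypeI (φ : BatchTest S) (A : Set (ProbabilityMeasure S)) (n : ℕ) : ℝ≥0∞ :=
  ⨆ P₀ ∈ A, ∫⁻ x, ENNReal.ofReal (φ.prob n x) ∂(iidLaw P₀ n)

/-- Type-II error `E_{P₁}[1 - φ(xⁿ)]`. -/
def typeII (φ : BatchTest S) (P₁ : ProbabilityMeasure S) (n : ℕ) : ℝ≥0∞ :=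
  ∫⁻ x, ENNReal.ofReal (1 - φ.prob n x) ∂(iidLaw P₁ n)

end BatchTest

/-- `-(1/n) log p`, with `log 0 = -∞`. -/
def normalizedNegLog (n : ℕ) (p : ℝ≥0∞) : EReal :=
  -(((1 / (n : ℝ) : ℝ) : EReal) * ENNReal.log p)

/-- Worst-case type-II error exponent of an arbitrary test. The upper limit is taken
because the limit need not exist for every test. -/
def BatchTest.worstExponent {S : Type*} [MeasurableSpace S] (φ : BatchTest S)
    (B : Set (ProbabilityMeasure S)) : EReal :=
  ⨅ P₁ ∈ B, limsup (fun n : ℕ => normalizedNegLog n (φ.typeII P₁ n)) atTop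

/-- Value of the robust asymptotic Neyman-Pearson problem: the largest worst-case type-II
error exponent of a test whose worst-case type-I error is at most `α` at every sample size. -/
def neymanPearsonValue {S : Type*} [MeasurableSpace S] (A B : Set (ProbabilityMeasure S))
    (α : ℝ) : EReal :=
  ⨆ φ ∈ {φ : BatchTest S | ∀ n : ℕ, 1 ≤ n → φ.worstTypeI A n ≤ ENNReal.ofReal α},
    φ.worstExponent B

/-- `inf_{P₀ ∈ A, P₁ ∈ B} D(P₀ ‖ P₁)`. -/
def infKL {S : Type*} [MeasurableSpace S] (A B : Set (ProbabilityMeasure S)) : ℝ≥0∞ :=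
  ⨅ P₀ ∈ A, ⨅ P₁ ∈ B, InformationTheory.klDiv (P₀ : Measure S) (P₁ : Measure S)

end

theorem le_coe_of_forall_pos_le_coe_add {x : EReal} {a : ℝ}
    (h : ∀ ε : ℝ, 0 < ε → x ≤ ((a + ε : ℝ) : EReal)) : x ≤ (a : EReal) := by
  have h1 : Tendsto (fun ε : ℝ => ((a + ε : ℝ) : EReal)) (𝓝[>] 0) (𝓝 ((a : ℝ) : EReal)) := by
    refine (continuous_coe_real_ereal.tendsto a).comp ?_
    have : Tendsto (fun ε : ℝ => a + ε) (𝓝 0) (𝓝 (a + 0)) := by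
      exact (continuous_const.add continuous_id).tendsto 0
    rw [add_zero] at this
    exact this.mono_left nhdsWithin_le_nhds
  refine ge_of_tendsto h1 ?_
  filter_upwards [self_mem_nhdsWithin] with ε hε using h ε hε

theorem normalizedNegLog_anti (n : ℕ) {p q : ℝ≥0∞} (h : p ≤ q) :
    normalizedNegLog n q ≤ normalizedNegLog n p := by
  unfold normalizedNegLog
  rw [EReal.neg_le_neg_iff]
  exact mul_le_mul_of_nonneg_left (ENNReal.log_monotone h)
    (EReal.coe_nonneg.2 (by positivity))

theorem normalizedNegLog_nonneg (n : ℕ) {p : ℝ≥0∞} (h : p ≤ 1) :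
    0 ≤ normalizedNegLog n p := by
  refine le_trans ?_ (normalizedNegLog_anti n h)
  simp [normalizedNegLog]

theorem normalizedNegLog_zero {n : ℕ} (hn : 1 ≤ n) : normalizedNegLog n 0 = ⊤ := by
  have : (0 : ℝ) < 1 / n := by positivity
  simp only [normalizedNegLog, ENNReal.log_zero]
  rw [EReal.coe_mul_bot_of_pos this, EReal.neg_bot]

theorem normalizedNegLog_ofReal_exp (n : ℕ) (x : ℝ) :
    normalizedNegLog n (ENNReal.ofReal (Real.exp x)) = ((-(x / n) : ℝ) : EReal) := by
  simp only [normalizedNegLog, ENNReal.log_ofReal_of_pos (Real.exp_pos x), Real.log_exp]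
  rw [← EReal.coe_mul, ← EReal.coe_neg]
  congr 2
  ring

theorem limsup_normalizedNegLog_le {p : ℕ → ℝ≥0∞} {β a : ℝ} (hβ : 0 < β)
    (h : ∀ᶠ n : ℕ in atTop, ENNReal.ofReal (β * Real.exp (-(n * a))) ≤ p n) :
    limsup (fun n => normalizedNegLog n (p n)) atTop ≤ (a : EReal) := by
  have h1 : Tendsto (fun n : ℕ => ((a - Real.log β / n : ℝ) : EReal)) atTop
      (𝓝 ((a : ℝ) : EReal)) := by
    refine (continuous_coe_real_ereal.tendsto a).comp ?_
    have := (tendsto_const_nhds (x := a)).sub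
      (tendsto_const_div_atTop_nhds_zero_nat (Real.log β))
    simpa using this
  rw [← h1.limsup_eq]
  refine limsup_le_limsup ?_
  filter_upwards [h, eventually_ge_atTop 1] with n hn hn1
  refine (normalizedNegLog_anti n hn).trans ?_
  have : β * Real.exp (-(n * a)) = Real.exp (Real.log β - n * a) := by
    rw [sub_eq_add_neg, Real.exp_add, Real.exp_log hβ]
  rw [this, normalizedNegLog_ofReal_exp]
  have hn0 : (n : ℝ) ≠ 0 := by positivity
  refine le_of_eq ?_
  congr 1
  field_simp
  ring

theorem le_liminf_normalizedNegLog {p : ℕ → ℝ≥0∞} {u : ℕ → ℝ} {a : ℝ}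
    (hu : Tendsto u atTop (𝓝 a))
    (h : ∀ᶠ n : ℕ in atTop, p n ≤ ENNReal.ofReal (Real.exp (-(n * u n)))) :
    (a : EReal) ≤ liminf (fun n => normalizedNegLog n (p n)) atTop := by
  have h1 : Tendsto (fun n : ℕ => ((u n : ℝ) : EReal)) atTop (𝓝 ((a : ℝ) : EReal)) :=
    (continuous_coe_real_ereal.tendsto a).comp hu
  rw [← h1.liminf_eq]
  refine liminf_le_liminf ?_
  filter_upwards [h, eventually_ge_atTop 1] with n hn hn1
  refine le_trans ?_ (normalizedNegLog_anti n hn)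
  rw [normalizedNegLog_ofReal_exp]
  have hn0 : (n : ℝ) ≠ 0 := by positivity
  refine le_of_eq ?_
  congr 1
  field_simp

section KL

variable {S : Type*} [MeasurableSpace S]

open InformationTheory

theorem klDiv_le_of_le_withDensity_exp (μ ν : Measure S) [IsProbabilityMeasure μ]
    [IsProbabilityMeasure ν] {g : S → ℝ} (hg : Measurable g) (hgi : Integrable g μ)
    (h : μ ≤ ν.withDensity fun x => ENNReal.ofReal (Real.exp (g x))) :
    klDiv μ ν ≤ ENNReal.ofReal (∫ x, g x ∂μ) := by
  have hac : μ ≪ ν :=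
    (Measure.absolutelyContinuous_of_le h).trans (withDensity_absolutelyContinuous _ _)
  have hmg : Measurable fun x => ENNReal.ofReal (Real.exp (g x)) := by fun_prop
  have hr : ∀ᵐ x ∂ν, μ.rnDeriv ν x ≤ ENNReal.ofReal (Real.exp (g x)) := by
    refine ae_le_of_forall_setLIntegral_le_of_sigmaFinite (Measure.measurable_rnDeriv _ _) ?_
    intro s hs _
    rw [Measure.setLIntegral_rnDeriv hac, ← withDensity_apply _ hs]
    exact h s
  have hrr : ∀ᵐ x ∂ν, (μ.rnDeriv ν x).toReal ≤ Real.exp (g x) := by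
    filter_upwards [hr] with x hx
    exact ENNReal.toReal_le_of_le_ofReal (Real.exp_pos _).le hx
  have hint : Integrable (fun x => (μ.rnDeriv ν x).toReal * g x) ν := by
    simpa [smul_eq_mul] using (integrable_rnDeriv_smul_iff hac).2 hgi
  have hint1 : Integrable (fun x => (μ.rnDeriv ν x).toReal) ν :=
    Measure.integrable_toReal_rnDeriv
  have hpt : ∀ᵐ x ∂ν, klFun (μ.rnDeriv ν x).toReal
      ≤ (μ.rnDeriv ν x).toReal * g x + 1 - (μ.rnDeriv ν x).toReal := by
    filter_upwards [hrr] with x hx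
    have h0 : 0 ≤ (μ.rnDeriv ν x).toReal := ENNReal.toReal_nonneg
    rw [klFun_apply]
    rcases h0.eq_or_lt with h0 | h0
    · simp [← h0]
    · have : Real.log (μ.rnDeriv ν x).toReal ≤ g x := by
        rw [← Real.log_exp (g x)]
        exact Real.log_le_log h0 hx
      have := mul_le_mul_of_nonneg_left this h0.le
      linarith
  have hI : Integrable (fun x => (μ.rnDeriv ν x).toReal * g x + 1 - (μ.rnDeriv ν x).toReal) ν :=
    (hint.add (integrable_const 1)).sub hint1
  rw [klDiv_eq_lintegral_klFun_of_ac hac]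
  calc ∫⁻ x, ENNReal.ofReal (klFun (μ.rnDeriv ν x).toReal) ∂ν
      ≤ ∫⁻ x, ENNReal.ofReal
          ((μ.rnDeriv ν x).toReal * g x + 1 - (μ.rnDeriv ν x).toReal) ∂ν :=
        lintegral_mono_ae (hpt.mono fun x hx => ENNReal.ofReal_le_ofReal hx)
    _ = ENNReal.ofReal
          (∫ x, ((μ.rnDeriv ν x).toReal * g x + 1 - (μ.rnDeriv ν x).toReal) ∂ν) := by
        rw [ofReal_integral_eq_lintegral_ofReal hI]
        exact hpt.mono fun x hx => (klFun_nonneg ENNReal.toReal_nonneg).trans hx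
    _ = ENNReal.ofReal (∫ x, g x ∂μ) := by
        congr 1
        refine (integral_sub (hint.add (integrable_const 1)) hint1).trans ?_
        rw [integral_add' hint (integrable_const 1), Measure.integral_toReal_rnDeriv hac]
        have := integral_rnDeriv_smul hac (f := g)
        simp only [smul_eq_mul] at this
        rw [this]
        simp

theorem le_withDensity_exp_llr (μ ν : Measure S) [IsProbabilityMeasure μ]
    [IsProbabilityMeasure ν] (hac : μ ≪ ν) :
    μ ≤ ν.withDensity fun x => ENNReal.ofReal (Real.exp (llr μ ν x)) := by
  conv_lhs => rw [← Measure.withDensity_rnDeriv_eq μ ν hac]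
  refine withDensity_mono ?_
  filter_upwards [exp_llr μ ν, Measure.rnDeriv_lt_top μ ν] with x hx hx1
  rw [hx]
  split_ifs with h0
  · simp [h0]
  · rw [ENNReal.ofReal_toReal hx1.ne]

theorem integral_llr_eq_toReal_klDiv (μ ν : Measure S) [IsProbabilityMeasure μ]
    [IsProbabilityMeasure ν] (hac : μ ≪ ν) :
    ∫ x, llr μ ν x ∂μ = (klDiv μ ν).toReal := by
  rw [toReal_klDiv_of_measure_eq hac (by simp)]

theorem klDiv_le_add_log_of_le_smul (μ ν ν' : Measure S) [IsProbabilityMeasure μ]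
    [IsProbabilityMeasure ν] [IsProbabilityMeasure ν'] {K : ℝ} (hK : 0 < K)
    (h : ν ≤ ENNReal.ofReal K • ν') (hfin : klDiv μ ν ≠ ⊤) :
    klDiv μ ν' ≤ ENNReal.ofReal ((klDiv μ ν).toReal + Real.log K) := by
  obtain ⟨hac, hint⟩ := klDiv_ne_top_iff.1 hfin
  have hm : Measurable (llr μ ν) := measurable_llr _ _
  refine (klDiv_le_of_le_withDensity_exp μ ν' (g := fun x => llr μ ν x + Real.log K)
    (by fun_prop) (hint.add (integrable_const _)) ?_).trans (le_of_eq ?_)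
  · refine (le_withDensity_exp_llr μ ν hac).trans ?_
    have : (fun x => ENNReal.ofReal (Real.exp (llr μ ν x + Real.log K)))
        = ENNReal.ofReal K • fun x => ENNReal.ofReal (Real.exp (llr μ ν x)) := by
      ext x
      simp only [Pi.smul_apply, smul_eq_mul]
      rw [Real.exp_add, Real.exp_log hK, mul_comm, ENNReal.ofReal_mul hK.le]
    rw [this, withDensity_smul _ (by fun_prop), ← withDensity_smul_measure]
    refine Measure.le_iff.2 fun s hs => ?_
    rw [withDensity_apply _ hs, withDensity_apply _ hs]
    exact lintegral_mono' (Measure.restrict_mono le_rfl h) le_rfl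
  · rw [integral_add hint (integrable_const _), integral_llr_eq_toReal_klDiv _ _ hac]
    simp

theorem klDiv_smul_add_smul_le (μ₀ μ₁ ν : Measure S) [IsProbabilityMeasure μ₀]
    [IsProbabilityMeasure μ₁] [IsProbabilityMeasure ν] {a b : ℝ} (ha : 0 < a) (hb : 0 < b)
    (hab : a + b = 1) :
    klDiv (ENNReal.ofReal a • μ₀ + ENNReal.ofReal b • μ₁) ν
      ≤ ENNReal.ofReal a * klDiv μ₀ ν + ENNReal.ofReal b * klDiv μ₁ ν := by
  have ha' : ENNReal.ofReal a ≠ 0 := by simpa using ha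
  have hb' : ENNReal.ofReal b ≠ 0 := by simpa using hb
  by_cases h0 : μ₀ ≪ ν
  swap
  · simp [klDiv_of_not_ac h0, ENNReal.mul_top ha']
  by_cases h1 : μ₁ ≪ ν
  swap
  · simp [klDiv_of_not_ac h1, ENNReal.mul_top hb']
  have : IsFiniteMeasure (ENNReal.ofReal a • μ₀) := Measure.smul_finite _ ENNReal.ofReal_ne_top
  have : IsFiniteMeasure (ENNReal.ofReal b • μ₁) := Measure.smul_finite _ ENNReal.ofReal_ne_top
  have hac : ENNReal.ofReal a • μ₀ + ENNReal.ofReal b • μ₁ ≪ ν :=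
    Measure.AbsolutelyContinuous.add_left (h0.smul_left _) (h1.smul_left _)
  rw [klDiv_eq_lintegral_klFun_of_ac hac, klDiv_eq_lintegral_klFun_of_ac h0,
    klDiv_eq_lintegral_klFun_of_ac h1, ← lintegral_const_mul _ (by fun_prop),
    ← lintegral_const_mul _ (by fun_prop), ← lintegral_add_left (by fun_prop)]
  refine lintegral_mono_ae ?_
  filter_upwards [Measure.rnDeriv_add (ENNReal.ofReal a • μ₀) (ENNReal.ofReal b • μ₁) ν,
    Measure.rnDeriv_smul_left_of_ne_top μ₀ ν (r := ENNReal.ofReal a) ENNReal.ofReal_ne_top,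
    Measure.rnDeriv_smul_left_of_ne_top μ₁ ν (r := ENNReal.ofReal b) ENNReal.ofReal_ne_top,
    Measure.rnDeriv_lt_top μ₀ ν, Measure.rnDeriv_lt_top μ₁ ν] with x e1 e2 e3 f0 f1
  rw [e1, Pi.add_apply, e2, e3, Pi.smul_apply, Pi.smul_apply, smul_eq_mul, smul_eq_mul,
    ENNReal.toReal_add (ENNReal.mul_ne_top ENNReal.ofReal_ne_top f0.ne)
      (ENNReal.mul_ne_top ENNReal.ofReal_ne_top f1.ne),
    ENNReal.toReal_mul, ENNReal.toReal_mul, ENNReal.toReal_ofReal ha.le,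
    ENNReal.toReal_ofReal hb.le, ← ENNReal.ofReal_mul ha.le, ← ENNReal.ofReal_mul hb.le,
    ← ENNReal.ofReal_add (mul_nonneg ha.le (klFun_nonneg ENNReal.toReal_nonneg))
      (mul_nonneg hb.le (klFun_nonneg ENNReal.toReal_nonneg))]
  refine ENNReal.ofReal_le_ofReal ?_
  have := convexOn_klFun.2 (x := (μ₀.rnDeriv ν x).toReal) ENNReal.toReal_nonneg
    (y := (μ₁.rnDeriv ν x).toReal) ENNReal.toReal_nonneg ha.le hb.le hab
  simpa [smul_eq_mul] using this

end KL

section Iid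

variable {S : Type*} [MeasurableSpace S]

open ProbabilityTheory InformationTheory

instance (P : ProbabilityMeasure S) (n : ℕ) : IsProbabilityMeasure (iidLaw P n) := by
  unfold iidLaw; infer_instance

theorem iIndepFun_iidLaw (P : ProbabilityMeasure S) (n : ℕ) {T : Type*} [MeasurableSpace T]
    {g : S → T} (hg : Measurable g) :
    iIndepFun (fun (i : Fin n) (x : Fin n → S) => g (x i)) (iidLaw P n) :=
  iIndepFun_pi (μ := fun _ : Fin n => (P : Measure S)) (X := fun _ => g)
    fun _ => hg.aemeasurable

theorem measurePreserving_eval_iidLaw (P : ProbabilityMeasure S) (n : ℕ) (i : Fin n) :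
    MeasurePreserving (fun x : Fin n → S => x i) (iidLaw P n) (P : Measure S) :=
  measurePreserving_eval (fun _ : Fin n => (P : Measure S)) i

theorem map_infinitePi_eq_iidLaw (P : ProbabilityMeasure S) (n : ℕ) :
    (Measure.infinitePi fun _ : ℕ => (P : Measure S)).map (fun ω (i : Fin n) => ω i)
      = iidLaw P n := by
  rw [Measure.map_infinitePi_infinitePi_of_inj (P := fun _ : ℕ => (P : Measure S))
    (f := fun i : Fin n => (i : ℕ)) Fin.val_injective, Measure.infinitePi_eq_pi]
  rfl

theorem tendsto_iidLaw_lt_sum (P : ProbabilityMeasure S) {g : S → ℝ} (hg : Measurable g)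
    (hgi : Integrable g (P : Measure S)) {a : ℝ} (ha : ∫ x, g x ∂(P : Measure S) < a) :
    Tendsto (fun n : ℕ => iidLaw P n {x | n * a < ∑ i, g (x i)}) atTop (𝓝 0) := by
  set Q := Measure.infinitePi fun _ : ℕ => (P : Measure S) with hQ
  have hev : ∀ i, MeasurePreserving (fun ω : ℕ → S => ω i) Q (P : Measure S) := fun i =>
    measurePreserving_eval_infinitePi (fun _ : ℕ => (P : Measure S)) i
  have hint : ∫ ω, g (ω 0) ∂Q = ∫ x, g x ∂(P : Measure S) := by
    rw [← (hev 0).map_eq, integral_map (hev 0).measurable.aemeasurable]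
    rw [(hev 0).map_eq]
    exact hg.aestronglyMeasurable
  have hslln := strong_law_ae_real (μ := Q) (fun i ω => g (ω i))
    ((hev 0).integrable_comp_of_integrable hgi)
    (fun i j hij => (iIndepFun_infinitePi (P := fun _ : ℕ => (P : Measure S))
      (X := fun _ => g) fun _ => hg).indepFun hij)
    (fun i => by
      refine ⟨(hg.comp (hev i).measurable).aemeasurable,
        (hg.comp (hev 0).measurable).aemeasurable, ?_⟩
      change Measure.map (g ∘ fun ω : ℕ → S => ω i) Q = Measure.map (g ∘ fun ω : ℕ → S => ω 0) Q
      rw [← Measure.map_map hg (by fun_prop), ← Measure.map_map hg (by fun_prop),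
        (hev i).map_eq, (hev 0).map_eq])
  have hmeas : TendstoInMeasure Q (fun (n : ℕ) ω => (∑ i ∈ Finset.range n, g (ω i)) / n) atTop
      (fun _ => ∫ ω, g (ω 0) ∂Q) :=
    tendstoInMeasure_of_tendsto_ae
      (fun n => Measurable.aestronglyMeasurable (by fun_prop)) hslln
  have h0 := hmeas (ENNReal.ofReal (a - ∫ x, g x ∂(P : Measure S))) (by simpa using ha)
  refine tendsto_of_tendsto_of_tendsto_of_le_of_le' tendsto_const_nhds h0
    (Eventually.of_forall fun _ => zero_le) ?_
  filter_upwards [eventually_ge_atTop 1] with n hn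
  rw [← map_infinitePi_eq_iidLaw, Measure.map_apply (by fun_prop)
    (measurableSet_lt (by fun_prop) (by fun_prop))]
  refine measure_mono fun ω hω => ?_
  simp only [Set.preimage_ofPred_eq, Set.mem_ofPred_eq] at hω ⊢
  rw [Fin.sum_univ_eq_sum_range (fun i => g (ω i)) n] at hω
  rw [edist_dist, hint, Real.dist_eq]
  refine ENNReal.ofReal_le_ofReal (le_trans ?_ (le_abs_self _))
  have hn0 : (0 : ℝ) < n := by positivity
  have : a < (∑ i ∈ Finset.range n, g (ω i)) / n := by
    rw [lt_div_iff₀ hn0]; linarith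
  linarith

theorem iidLaw_eq_withDensity {P₀ P₁ : ProbabilityMeasure S} {r : S → ℝ≥0∞}
    (hr : Measurable r) (h : (P₀ : Measure S) = (P₁ : Measure S).withDensity r) (n : ℕ) :
    iidLaw P₀ n = (iidLaw P₁ n).withDensity fun x => ∏ i, r (x i) := by
  refine Measure.pi_eq fun s hs => ?_
  have hprod : MeasurableSet (Set.univ.pi s) := MeasurableSet.univ_pi hs
  rw [withDensity_apply _ hprod, ← lintegral_indicator hprod]
  have : ∀ x : Fin n → S, (Set.univ.pi s).indicator (fun x => ∏ i, r (x i)) x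
      = ∏ i, (s i).indicator r (x i) := by
    intro x
    by_cases hx : x ∈ Set.univ.pi s
    · rw [Set.indicator_of_mem hx]
      exact Finset.prod_congr rfl fun i _ => (Set.indicator_of_mem (hx i trivial) r).symm
    · rw [Set.indicator_of_notMem hx]
      simp only [Set.mem_pi, Set.mem_univ, true_implies, not_forall] at hx
      obtain ⟨i, hi⟩ := hx
      exact (Finset.prod_eq_zero (Finset.mem_univ i) (Set.indicator_of_notMem hi r)).symm
  simp_rw [this]
  have hind : iIndepFun (fun (i : Fin n) (x : Fin n → S) => (s i).indicator r (x i))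
      (iidLaw P₁ n) :=
    iIndepFun_pi (μ := fun _ : Fin n => (P₁ : Measure S)) (X := fun i => (s i).indicator r)
      fun i => (hr.indicator (hs i)).aemeasurable
  rw [lintegral_prod_eq_prod_lintegral_of_indepFun Finset.univ _ hind
    fun i => (hr.indicator (hs i)).comp (measurable_pi_apply i)]
  refine Finset.prod_congr rfl fun i _ => ?_
  rw [(measurePreserving_eval_iidLaw P₁ n i).lintegral_comp (hr.indicator (hs i)),
    lintegral_indicator (hs i), h, withDensity_apply _ (hs i)]

/-- Strong converse of Stein's lemma. -/
theorem limsup_normalizedNegLog_lintegral_le_klDiv (P₀ P₁ : ProbabilityMeasure S)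
    (f : ∀ n, (Fin n → S) → ℝ≥0∞) (hf : ∀ n, Measurable (f n)) (hf1 : ∀ n x, f n x ≤ 1)
    {β : ℝ} (hβ : 0 < β)
    (h : ∀ᶠ n : ℕ in atTop, ENNReal.ofReal β ≤ ∫⁻ x, f n x ∂(iidLaw P₀ n)) :
    limsup (fun n : ℕ => normalizedNegLog n (∫⁻ x, f n x ∂(iidLaw P₁ n))) atTop
      ≤ (klDiv (P₀ : Measure S) (P₁ : Measure S) : EReal) := by
  by_cases hfin : klDiv (P₀ : Measure S) (P₁ : Measure S) = ⊤
  · simp [hfin]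
  obtain ⟨hac, hint⟩ := klDiv_ne_top_iff.1 hfin
  rw [← ENNReal.ofReal_toReal hfin, EReal.coe_ennreal_ofReal, max_eq_left ENNReal.toReal_nonneg]
  set D := (klDiv (P₀ : Measure S) (P₁ : Measure S)).toReal with hD
  have hm : Measurable (llr (P₀ : Measure S) (P₁ : Measure S)) := measurable_llr _ _
  set g := llr (P₀ : Measure S) (P₁ : Measure S) with hg
  refine le_coe_of_forall_pos_le_coe_add fun ε hε => ?_
  refine limsup_normalizedNegLog_le (β := β / 2) (by positivity) ?_
  have hw := tendsto_iidLaw_lt_sum P₀ hm hint (a := D + ε)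
    (by rw [integral_llr_eq_toReal_klDiv _ _ hac]; linarith)
  have hw' : ∀ᶠ n : ℕ in atTop,
      iidLaw P₀ n {x | n * (D + ε) < ∑ i, g (x i)} < ENNReal.ofReal (β / 2) :=
    hw.eventually_lt_const (by simpa using hβ)
  filter_upwards [h, hw'] with n hn hn'
  set B : Set (Fin n → S) := {x | n * (D + ε) < ∑ i, g (x i)} with hB
  have hBm : MeasurableSet B := measurableSet_lt (by fun_prop) (by fun_prop)
  have hrm : Measurable ((P₀ : Measure S).rnDeriv (P₁ : Measure S)) := Measure.measurable_rnDeriv _ _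
  have hrtop : ∀ᵐ x ∂(iidLaw P₁ n), ∀ i,
      (P₀ : Measure S).rnDeriv (P₁ : Measure S) (x i) < ⊤ := by
    rw [ae_all_iff]
    intro i
    exact (measurePreserving_eval_iidLaw P₁ n i).quasiMeasurePreserving.ae
      (Measure.rnDeriv_lt_top _ _)
  have hden := iidLaw_eq_withDensity hrm (Measure.withDensity_rnDeriv_eq _ _ hac).symm n
  have h1 : ∫⁻ x in Bᶜ, f n x ∂(iidLaw P₀ n)
      ≤ ENNReal.ofReal (Real.exp (n * (D + ε))) * ∫⁻ x, f n x ∂(iidLaw P₁ n) := by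
    rw [hden, restrict_withDensity hBm.compl,
      lintegral_withDensity_eq_lintegral_mul _ (by fun_prop) (hf n),
      ← lintegral_const_mul _ (hf n)]
    refine le_trans ?_ (setLIntegral_le_lintegral Bᶜ _)
    refine setLIntegral_mono_ae (by fun_prop) ?_
    filter_upwards [hrtop] with x hx hxB
    rw [Pi.mul_apply]
    refine mul_le_mul_left ?_ _
    by_cases hz : ∃ i, (P₀ : Measure S).rnDeriv (P₁ : Measure S) (x i) = 0
    · obtain ⟨i, hi⟩ := hz
      rw [Finset.prod_eq_zero (Finset.mem_univ i) hi]
      exact zero_le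
    · push Not at hz
      have : ∀ i, (P₀ : Measure S).rnDeriv (P₁ : Measure S) (x i)
          = ENNReal.ofReal (Real.exp (g (x i))) := by
        intro i
        rw [hg, llr_def]
        simp only
        rw [Real.exp_log (ENNReal.toReal_pos (hz i) (hx i).ne), ENNReal.ofReal_toReal (hx i).ne]
      simp_rw [this]
      rw [← ENNReal.ofReal_prod_of_nonneg fun i _ => (Real.exp_pos _).le, ← Real.exp_sum]
      refine ENNReal.ofReal_le_ofReal (Real.exp_le_exp.2 ?_)
      simpa [hB] using hxB
  have h2 : ∫⁻ x in B, f n x ∂(iidLaw P₀ n) ≤ ENNReal.ofReal (β / 2) := by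
    refine le_trans ?_ hn'.le
    calc ∫⁻ x in B, f n x ∂(iidLaw P₀ n) ≤ ∫⁻ x in B, 1 ∂(iidLaw P₀ n) :=
          lintegral_mono fun x => hf1 n x
      _ = iidLaw P₀ n B := by simp
  have h3 : ENNReal.ofReal (β / 2) ≤
      ENNReal.ofReal (Real.exp (n * (D + ε))) * ∫⁻ x, f n x ∂(iidLaw P₁ n) := by
    have h4 : ENNReal.ofReal (β / 2) + ENNReal.ofReal (β / 2) ≤ ENNReal.ofReal (β / 2) +
        ENNReal.ofReal (Real.exp (n * (D + ε))) * ∫⁻ x, f n x ∂(iidLaw P₁ n) := by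
      rw [← ENNReal.ofReal_add (by positivity) (by positivity), add_halves]
      refine hn.trans ?_
      rw [← lintegral_add_compl (f n) hBm]
      exact add_le_add h2 h1
    exact (ENNReal.add_le_add_iff_left ENNReal.ofReal_ne_top).1 h4
  rw [ENNReal.ofReal_mul (by positivity)]
  calc ENNReal.ofReal (β / 2) * ENNReal.ofReal (Real.exp (-(n * (D + ε))))
      ≤ (ENNReal.ofReal (Real.exp (n * (D + ε))) * ∫⁻ x, f n x ∂(iidLaw P₁ n))
          * ENNReal.ofReal (Real.exp (-(n * (D + ε)))) := mul_le_mul_left h3 _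
    _ = ∫⁻ x, f n x ∂(iidLaw P₁ n) := by
      rw [mul_right_comm, ← ENNReal.ofReal_mul (Real.exp_pos _).le, ← Real.exp_add]
      simp

end Iid

section Exponent

variable {S : Type*} [MeasurableSpace S]

open ProbabilityTheory InformationTheory

theorem exists_convexCombination (P R : ProbabilityMeasure S) {a b : ℝ} (ha : 0 ≤ a) (hb : 0 ≤ b)
    (hab : a + b = 1) :
    ∃ Q : ProbabilityMeasure S, (Q : Measure S)
      = ENNReal.ofReal a • (P : Measure S) + ENNReal.ofReal b • (R : Measure S) := by
  refine ⟨⟨_, ⟨?_⟩⟩, rfl⟩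
  simp [← ENNReal.ofReal_add ha hb, hab]

theorem integrable_of_abs_le {ψ : S → ℝ} (hψ : Measurable ψ) {C : ℝ} (hC : ∀ x, |ψ x| ≤ C)
    (μ : Measure S) [IsFiniteMeasure μ] : Integrable ψ μ :=
  Integrable.of_bound hψ.aestronglyMeasurable C (ae_of_all _ hC)

theorem integral_convexCombination {ψ : S → ℝ} (hψ : Measurable ψ) {C : ℝ} (hC : ∀ x, |ψ x| ≤ C)
    {Q P R : ProbabilityMeasure S} {a b : ℝ} (ha : 0 ≤ a) (hb : 0 ≤ b)
    (hQ : (Q : Measure S)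
      = ENNReal.ofReal a • (P : Measure S) + ENNReal.ofReal b • (R : Measure S)) :
    ∫ x, ψ x ∂(Q : Measure S)
      = a * ∫ x, ψ x ∂(P : Measure S) + b * ∫ x, ψ x ∂(R : Measure S) := by
  rw [hQ, integral_add_measure, integral_smul_measure, integral_smul_measure,
    ENNReal.toReal_ofReal ha, ENNReal.toReal_ofReal hb, smul_eq_mul, smul_eq_mul]
  · exact (integrable_of_abs_le hψ hC _).smul_measure ENNReal.ofReal_ne_top
  · exact (integrable_of_abs_le hψ hC _).smul_measure ENNReal.ofReal_ne_top

theorem measurable_sampleMean {ψ : S → ℝ} (hψ : Measurable ψ) (n : ℕ) :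
    Measurable fun x : Fin n → S => sampleMean ψ x := by
  unfold sampleMean
  fun_prop

theorem sampleMean_lt_iff {T : Type*} {ψ : T → ℝ} {n : ℕ} (hn : 1 ≤ n) (x : Fin n → T) (a : ℝ) :
    sampleMean ψ x < a ↔ ∑ i, ψ (x i) < n * a := by
  have hn0 : (0 : ℝ) < n := by positivity
  rw [sampleMean, one_div, inv_mul_lt_iff₀ hn0]

theorem le_sampleMean_iff {T : Type*} {ψ : T → ℝ} {n : ℕ} (hn : 1 ≤ n) (x : Fin n → T) (a : ℝ) :
    a ≤ sampleMean ψ x ↔ n * a ≤ ∑ i, ψ (x i) := by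
  rw [← not_lt, sampleMean_lt_iff hn, not_lt]

theorem klDiv_cond_le (P : Measure S) [IsProbabilityMeasure P] {s : Set S}
    (h0 : P s ≠ 0) : klDiv (cond P s) P ≤ ENNReal.ofReal (-Real.log (P.real s)) := by
  have := cond_isProbabilityMeasure h0
  have hpos : 0 < P.real s := ENNReal.toReal_pos h0 (measure_ne_top _ _)
  refine (klDiv_le_of_le_withDensity_exp _ _ (g := fun _ => -Real.log (P.real s))
    measurable_const (integrable_const _) ?_).trans (by simp)
  rw [withDensity_const, Real.exp_neg, Real.exp_log hpos, ENNReal.ofReal_inv_of_pos hpos,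
    measureReal_def, ENNReal.ofReal_toReal (measure_ne_top _ _), ProbabilityTheory.cond]
  refine Measure.le_iff.2 fun u _ => ?_
  simp only [Measure.smul_apply, smul_eq_mul]
  exact mul_le_mul_right (Measure.restrict_apply_le _ _) _

theorem exists_klDiv_ne_top_integral_lt {ψ : S → ℝ} (hψ : Measurable ψ) {C : ℝ}
    (hC : ∀ x, |ψ x| ≤ C) {t : ℝ} {P : ProbabilityMeasure S} (h : (P : Measure S) {x | ψ x < t} ≠ 0) :
    ∃ R : ProbabilityMeasure S, klDiv (R : Measure S) (P : Measure S) ≠ ⊤ ∧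
      ∫ x, ψ x ∂(R : Measure S) < t := by
  have hs : MeasurableSet {x | ψ x < t} := measurableSet_lt hψ measurable_const
  have hprob := cond_isProbabilityMeasure (μ := (P : Measure S)) h
  refine ⟨⟨cond (P : Measure S) {x | ψ x < t}, hprob⟩,
    ((klDiv_cond_le _ h).trans_lt ENNReal.ofReal_lt_top).ne, ?_⟩
  change ∫ x, ψ x ∂(cond (P : Measure S) {x | ψ x < t}) < t
  have hae : ∀ᵐ x ∂(cond (P : Measure S) {x | ψ x < t}), ψ x < t := ae_cond_mem hs
  have hi := integrable_of_abs_le hψ hC (cond (P : Measure S) {x | ψ x < t})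
  have h1 : 0 < ∫ x, (t - ψ x) ∂(cond (P : Measure S) {x | ψ x < t}) := by
    rw [integral_pos_iff_support_of_nonneg_ae (f := fun x => t - ψ x)
      (hae.mono fun x hx => by simpa using hx.le) ((integrable_const t).sub hi)]
    rw [measure_eq_measure_of_null_sdiff (Set.subset_univ _)]
    · simp
    · refine measure_mono_null ?_ (ae_iff.1 hae)
      intro x hx
      simp only [Set.mem_sdiff, Set.mem_univ, Function.mem_support, ne_eq, not_not, true_and] at hx
      simp only [Set.mem_ofPred_eq, not_lt]
      linarith
  rw [integral_sub (integrable_const t) hi] at h1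
  simpa using h1

theorem tendsto_iidLaw_sampleMean_ge {ψ : S → ℝ} (hψ : Measurable ψ) {C : ℝ}
    (hC : ∀ x, |ψ x| ≤ C) {t : ℝ} {P : ProbabilityMeasure S} (h : ∫ x, ψ x ∂(P : Measure S) < t) :
    Tendsto (fun n : ℕ => iidLaw P n {x | t ≤ sampleMean ψ x}) atTop (𝓝 0) := by
  obtain ⟨a, ha, hat⟩ := exists_between h
  refine tendsto_of_tendsto_of_tendsto_of_le_of_le' tendsto_const_nhds
    (tendsto_iidLaw_lt_sum P hψ (integrable_of_abs_le hψ hC _) ha)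
    (Eventually.of_forall fun _ => zero_le) ?_
  filter_upwards [eventually_ge_atTop 1] with n hn
  refine measure_mono fun x hx => ?_
  have hn0 : (0 : ℝ) < n := by positivity
  exact (mul_lt_mul_of_pos_left hat hn0).trans_le ((le_sampleMean_iff hn x t).1 hx)

theorem eventually_le_iidLaw_sampleMean_lt {ψ : S → ℝ} (hψ : Measurable ψ) {C : ℝ}
    (hC : ∀ x, |ψ x| ≤ C) {t : ℝ} {P : ProbabilityMeasure S} (h : ∫ x, ψ x ∂(P : Measure S) < t) :
    ∀ᶠ n : ℕ in atTop, ENNReal.ofReal (1 / 2) ≤ iidLaw P n {x | sampleMean ψ x < t} := by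
  filter_upwards [(tendsto_iidLaw_sampleMean_ge hψ hC h).eventually_lt_const
    (u := ENNReal.ofReal (1 / 2)) (by simp)] with n hn
  have hm : MeasurableSet {x : Fin n → S | t ≤ sampleMean ψ x} :=
    measurableSet_le measurable_const (measurable_sampleMean hψ n)
  have h1 := prob_add_prob_compl (μ := iidLaw P n) hm
  have h2 : {x : Fin n → S | t ≤ sampleMean ψ x}ᶜ = {x | sampleMean ψ x < t} := by
    ext x; simp
  rw [h2] at h1
  by_contra! hcon
  have := ENNReal.add_lt_add hn hcon
  rw [h1, ← ENNReal.ofReal_add (by norm_num) (by norm_num)] at this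
  norm_num at this

theorem limsup_iidLaw_sampleMean_lt_le_klDiv_of_lt {ψ : S → ℝ} (hψ : Measurable ψ) {C : ℝ}
    (hC : ∀ x, |ψ x| ≤ C) {t : ℝ} {P₀ : ProbabilityMeasure S} (P₁ : ProbabilityMeasure S)
    (h : ∫ x, ψ x ∂(P₀ : Measure S) < t) :
    limsup (fun n : ℕ => normalizedNegLog n (iidLaw P₁ n {x | sampleMean ψ x < t})) atTop
      ≤ (klDiv (P₀ : Measure S) (P₁ : Measure S) : EReal) := by
  have hm : ∀ n, MeasurableSet {x : Fin n → S | sampleMean ψ x < t} := fun n =>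
    measurableSet_lt (measurable_sampleMean hψ n) measurable_const
  have := limsup_normalizedNegLog_lintegral_le_klDiv P₀ P₁
    (fun n => {x : Fin n → S | sampleMean ψ x < t}.indicator 1)
    (fun n => measurable_one.indicator (hm n))
    (fun n x => Set.indicator_le_self' (by simp) x) (β := 1 / 2) (by norm_num)
    (by simpa [lintegral_indicator_one (hm _)] using eventually_le_iidLaw_sampleMean_lt hψ hC h)
  simpa [lintegral_indicator_one (hm _)] using this

theorem limsup_iidLaw_sampleMean_lt_le_klDiv {ψ : S → ℝ} (hψ : Measurable ψ) {C : ℝ}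
    (hC : ∀ x, |ψ x| ≤ C) {t : ℝ} {P₀ P₁ : ProbabilityMeasure S}
    (hpos : (P₁ : Measure S) {x | ψ x < t} ≠ 0) (h : ∫ x, ψ x ∂(P₀ : Measure S) ≤ t) :
    limsup (fun n : ℕ => normalizedNegLog n (iidLaw P₁ n {x | sampleMean ψ x < t})) atTop
      ≤ (klDiv (P₀ : Measure S) (P₁ : Measure S) : EReal) := by
  by_cases hfin : klDiv (P₀ : Measure S) (P₁ : Measure S) = ⊤
  · simp [hfin]
  obtain ⟨R, hR, hRt⟩ := exists_klDiv_ne_top_integral_lt hψ hC hpos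
  rw [← ENNReal.ofReal_toReal hfin, EReal.coe_ennreal_ofReal, max_eq_left ENNReal.toReal_nonneg]
  refine le_coe_of_forall_pos_le_coe_add fun ε hε => ?_
  set D := (klDiv (P₀ : Measure S) (P₁ : Measure S)).toReal with hD
  set E := (klDiv (R : Measure S) (P₁ : Measure S)).toReal with hE
  have hD0 : 0 ≤ D := ENNReal.toReal_nonneg
  have hE0 : 0 ≤ E := ENNReal.toReal_nonneg
  obtain ⟨b, hb0, hb1, hbE⟩ : ∃ b : ℝ, 0 < b ∧ b < 1 ∧ b * E ≤ ε := by
    refine ⟨min (1 / 2) (ε / (E + 1)), by positivity, by norm_num, ?_⟩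
    calc min (1 / 2) (ε / (E + 1)) * E ≤ ε / (E + 1) * E :=
          mul_le_mul_of_nonneg_right (min_le_right _ _) hE0
      _ ≤ ε := by rw [div_mul_eq_mul_div, div_le_iff₀ (by positivity)]; nlinarith
  obtain ⟨Q, hQ⟩ := exists_convexCombination P₀ R (a := 1 - b) (b := b) (by linarith) hb0.le
    (by ring)
  have hQt : ∫ x, ψ x ∂(Q : Measure S) < t := by
    rw [integral_convexCombination hψ hC (by linarith) hb0.le hQ]
    nlinarith
  have hkl := klDiv_smul_add_smul_le (P₀ : Measure S) (R : Measure S) (P₁ : Measure S) (a := 1 - b) (b := b) (by linarith) hb0 (by ring)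
  rw [← hQ, ← ENNReal.ofReal_toReal hfin, ← ENNReal.ofReal_toReal hR, ← hD, ← hE,
    ← ENNReal.ofReal_mul (by linarith), ← ENNReal.ofReal_mul hb0.le,
    ← ENNReal.ofReal_add (mul_nonneg (by linarith) hD0) (mul_nonneg hb0.le hE0)] at hkl
  refine (limsup_iidLaw_sampleMean_lt_le_klDiv_of_lt hψ hC P₁ hQt).trans ?_
  refine (EReal.coe_ennreal_le_coe_ennreal_iff.2 hkl).trans ?_
  rw [EReal.coe_ennreal_ofReal, EReal.coe_le_coe_iff]
  refine max_le ?_ (by positivity)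
  nlinarith

theorem integrable_exp_mul_const_sub {ψ : S → ℝ} (hψ : Measurable ψ) {C : ℝ}
    (hC : ∀ x, |ψ x| ≤ C) (t l : ℝ) (μ : Measure S) [IsFiniteMeasure μ] :
    Integrable (fun x => Real.exp (l * (t - ψ x))) μ := by
  refine Integrable.of_bound (Measurable.aestronglyMeasurable (by fun_prop))
    (Real.exp (|l| * (|t| + C))) (ae_of_all _ fun x => ?_)
  rw [Real.norm_eq_abs, Real.abs_exp, Real.exp_le_exp]
  refine (le_abs_self _).trans ?_
  rw [abs_mul]
  gcongr
  exact (abs_sub _ _).trans (by linarith [hC x])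

theorem iidLaw_sampleMean_lt_le_exp_cgf {ψ : S → ℝ} (hψ : Measurable ψ) {C : ℝ}
    (hC : ∀ x, |ψ x| ≤ C) (P : ProbabilityMeasure S) (t τ : ℝ) {l : ℝ} (hl : 0 ≤ l) {n : ℕ}
    (hn : 1 ≤ n) :
    iidLaw P n {x | sampleMean ψ x < τ} ≤ ENNReal.ofReal
      (Real.exp (-(n * (-(l * (τ - t)) - cgf (fun x => t - ψ x) (P : Measure S) l)))) := by
  have hind := iIndepFun_iidLaw P n (g := fun x => t - ψ x) (by fun_prop)
  have hmap : ∀ i : Fin n, cgf (fun x : Fin n → S => t - ψ (x i)) (iidLaw P n) l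
      = cgf (fun x => t - ψ x) (P : Measure S) l := by
    intro i
    rw [cgf, cgf, ← (measurePreserving_eval_iidLaw P n i).map_eq,
      mgf_map (Y := fun x : Fin n → S => x i) (measurable_pi_apply i).aemeasurable]
    · rfl
    · exact Measurable.aestronglyMeasurable (by fun_prop)
  have hinti : ∀ i : Fin n, Integrable (fun x : Fin n → S => Real.exp (l * (t - ψ (x i))))
      (iidLaw P n) := fun i =>
    (measurePreserving_eval_iidLaw P n i).integrable_comp_of_integrable
      (integrable_exp_mul_const_sub hψ hC t l _)
  have hsum := hind.cgf_sum (s := Finset.univ) (t := l) (fun i => by fun_prop)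
    (fun i _ => hinti i)
  have hch := measure_ge_le_exp_cgf (μ := iidLaw P n)
    (X := ∑ i : Fin n, fun x : Fin n → S => t - ψ (x i)) (n * (t - τ)) hl
    (hind.integrable_exp_mul_sum (fun i => by fun_prop) fun i _ => hinti i)
  rw [hsum, Finset.sum_congr rfl fun i _ => hmap i, Finset.sum_const, Finset.card_univ,
    Fintype.card_fin, nsmul_eq_mul] at hch
  have hsub : {x : Fin n → S | sampleMean ψ x < τ} ⊆
      {x | n * (t - τ) ≤ (∑ i : Fin n, fun x : Fin n → S => t - ψ (x i)) x} := by
    intro x hx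
    have := (sampleMean_lt_iff hn x τ).1 hx
    simp only [Set.mem_ofPred_eq, Finset.sum_apply, Finset.sum_sub_distrib, Finset.sum_const,
      Finset.card_univ, Fintype.card_fin, nsmul_eq_mul]
    linarith
  refine (measure_mono hsub).trans ?_
  rw [← ofReal_measureReal]
  refine ENNReal.ofReal_le_ofReal (hch.trans (le_of_eq ?_))
  congr 1
  ring

theorem neg_cgf_le_liminf_iidLaw {ψ : S → ℝ} (hψ : Measurable ψ) {C : ℝ}
    (hC : ∀ x, |ψ x| ≤ C) (P : ProbabilityMeasure S) {t : ℝ} {τ : ℕ → ℝ}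
    (hτ : Tendsto τ atTop (𝓝 t)) {l : ℝ} (hl : 0 ≤ l) :
    ((-cgf (fun x => t - ψ x) (P : Measure S) l : ℝ) : EReal) ≤
      liminf (fun n : ℕ => normalizedNegLog n (iidLaw P n {x | sampleMean ψ x < τ n})) atTop := by
  refine le_liminf_normalizedNegLog
    (u := fun n => -(l * (τ n - t)) - cgf (fun x => t - ψ x) (P : Measure S) l) ?_ ?_
  · have : Tendsto (fun n => -(l * (τ n - t)) - cgf (fun x => t - ψ x) (P : Measure S) l) atTop
        (𝓝 (-(l * (t - t)) - cgf (fun x => t - ψ x) (P : Measure S) l)) :=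
      ((hτ.sub_const t).const_mul l).neg.sub_const _
    simpa using this
  · filter_upwards [eventually_ge_atTop 1] with n hn
    exact iidLaw_sampleMean_lt_le_exp_cgf hψ hC P t (τ n) hl hn

end Exponent

section Limit

variable {S : Type*} [MeasurableSpace S]

open ProbabilityTheory InformationTheory

theorem exists_integral_mul_exp_eq_zero {Y : S → ℝ} (hY : Measurable Y) {C : ℝ}
    (hC : ∀ x, |Y x| ≤ C) (P : Measure S) [IsProbabilityMeasure P]
    (hneg : ∫ x, Y x ∂P < 0) (hpos : P {x | 0 < Y x} ≠ 0) :
    ∃ l : ℝ, 0 ≤ l ∧ ∫ x, Y x * Real.exp (l * Y x) ∂P = 0 := by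
  have hC0 : ∀ x, 0 ≤ C := fun x => (abs_nonneg _).trans (hC x)
  have hb : ∀ (l L : ℝ), |l| ≤ L → ∀ x, ‖Y x * Real.exp (l * Y x)‖ ≤ C * Real.exp (L * C) := by
    intro l L hl x
    rw [norm_mul, Real.norm_eq_abs, Real.norm_eq_abs, Real.abs_exp]
    refine mul_le_mul (hC x) (Real.exp_le_exp.2 ?_) (Real.exp_pos _).le (hC0 x)
    refine (le_abs_self _).trans ?_
    rw [abs_mul]
    exact mul_le_mul hl (hC x) (abs_nonneg _) ((abs_nonneg _).trans hl)
  have hm : ∀ l : ℝ, AEStronglyMeasurable (fun x => Y x * Real.exp (l * Y x)) P := fun l =>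
    Measurable.aestronglyMeasurable (by fun_prop)
  have hint : ∀ l : ℝ, Integrable (fun x => Y x * Real.exp (l * Y x)) P := fun l =>
    Integrable.of_bound (hm l) _ (ae_of_all _ (hb l |l| le_rfl))
  have hcont : Continuous fun l : ℝ => ∫ x, Y x * Real.exp (l * Y x) ∂P := by
    rw [continuous_iff_continuousAt]
    intro l₀
    refine continuousAt_of_dominated (Eventually.of_forall hm)
      (bound := fun _ => C * Real.exp ((|l₀| + 1) * C)) ?_ (integrable_const _)
      (ae_of_all _ fun x => by fun_prop)
    have : ∀ᶠ l : ℝ in 𝓝 l₀, |l| < |l₀| + 1 :=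
      (continuous_abs.tendsto l₀).eventually_lt_const (by linarith)
    filter_upwards [this] with l hl
    exact ae_of_all _ (hb l _ hl.le)
  obtain ⟨δ, hδ, hPδ⟩ : ∃ δ : ℝ, 0 < δ ∧ P {x | δ ≤ Y x} ≠ 0 := by
    by_contra! hcon
    refine hpos (measure_mono_null (t := ⋃ k : ℕ, {x | 1 / ((k : ℝ) + 1) ≤ Y x}) ?_
      (measure_iUnion_null fun k => hcon _ (by positivity)))
    intro x hx
    obtain ⟨k, hk⟩ := exists_nat_one_div_lt (show 0 < Y x from hx)
    exact Set.mem_iUnion.2 ⟨k, hk.le⟩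
  have hp : 0 < P.real {x | δ ≤ Y x} := ENNReal.toReal_pos hPδ (measure_ne_top _ _)
  have hms : MeasurableSet {x | δ ≤ Y x} := measurableSet_le measurable_const hY
  obtain ⟨b, hb0, hbC⟩ : ∃ b : ℝ, 0 ≤ b ∧ C < δ * (b * δ) * P.real {x | δ ≤ Y x} := by
    refine ⟨(|C| + 1) / (δ * δ * P.real {x | δ ≤ Y x}), by positivity, ?_⟩
    have : δ * ((|C| + 1) / (δ * δ * P.real {x | δ ≤ Y x}) * δ) * P.real {x | δ ≤ Y x}
        = |C| + 1 := by
      field_simp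
    rw [this]
    linarith [le_abs_self C]
  have hbig : 0 ≤ ∫ x, Y x * Real.exp (b * Y x) ∂P := by
    have hle : ∫ x, ({x | δ ≤ Y x}.indicator (fun _ => δ * (b * δ)) x - C) ∂P
        ≤ ∫ x, Y x * Real.exp (b * Y x) ∂P := by
      refine integral_mono (((integrable_const _).indicator hms).sub (integrable_const _))
        (hint b) fun x => ?_
      simp only
      by_cases hx : δ ≤ Y x
      · rw [Set.indicator_of_mem (show x ∈ {x | δ ≤ Y x} from hx)]
        have h1 : b * δ ≤ Real.exp (b * Y x) := by
          have := Real.add_one_le_exp (b * Y x)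
          nlinarith
        have h2 : δ * (b * δ) ≤ Y x * Real.exp (b * Y x) :=
          mul_le_mul hx h1 (by positivity) (hδ.le.trans hx)
        linarith [hC0 x]
      · rw [Set.indicator_of_notMem (show x ∉ {x | δ ≤ Y x} from hx)]
        rcases le_or_gt 0 (Y x) with h0 | h0
        · have := mul_nonneg h0 (Real.exp_pos (b * Y x)).le
          linarith [hC0 x]
        · have h1 : Real.exp (b * Y x) ≤ 1 := Real.exp_le_one_iff.2
            (mul_nonpos_of_nonneg_of_nonpos hb0 h0.le)
          have h2 := neg_abs_le (Y x)
          have h3 := hC x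
          nlinarith
    refine le_trans ?_ hle
    rw [integral_sub ((integrable_const _).indicator hms) (integrable_const _),
      integral_indicator_const _ hms]
    simp only [smul_eq_mul, integral_const, probReal_univ, one_mul]
    linarith
  obtain ⟨l, hl, hl0⟩ := intermediate_value_Icc hb0 hcont.continuousOn
    (show (0 : ℝ) ∈ Set.Icc _ _ from ⟨by simpa using hneg.le, hbig⟩)
  exact ⟨l, hl.1, hl0⟩

theorem exists_integral_eq_klDiv_le_neg_cgf {ψ : S → ℝ} (hψ : Measurable ψ) {C : ℝ}
    (hC : ∀ x, |ψ x| ≤ C) {t : ℝ} {P : ProbabilityMeasure S}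
    (hpos : (P : Measure S) {x | ψ x < t} ≠ 0) (h : t < ∫ x, ψ x ∂(P : Measure S)) :
    ∃ (l : ℝ) (Q : ProbabilityMeasure S), 0 ≤ l ∧ ∫ x, ψ x ∂(Q : Measure S) = t ∧
      klDiv (Q : Measure S) (P : Measure S)
        ≤ ENNReal.ofReal (-cgf (fun x => t - ψ x) (P : Measure S) l) := by
  have hi := integrable_of_abs_le hψ hC (P : Measure S)
  obtain ⟨l, hl0, hl⟩ := exists_integral_mul_exp_eq_zero (Y := fun x => t - ψ x)
    (by fun_prop) (C := |t| + C) (fun x => (abs_sub _ _).trans (by linarith [hC x]))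
    (P : Measure S)
    (by rw [integral_sub (integrable_const t) hi]; simpa using h) (by simpa using hpos)
  have hexp := integrable_exp_mul_const_sub hψ hC t l (P : Measure S)
  have hprob := isProbabilityMeasure_tilted hexp
  have hmgf : 0 < mgf (fun x => t - ψ x) (P : Measure S) l := mgf_pos hexp
  set Q : Measure S := (P : Measure S).tilted fun x => l * (t - ψ x) with hQ
  have hmean : ∫ x, (t - ψ x) ∂Q = 0 := by
    rw [hQ, integral_tilted]
    have : (fun x => (Real.exp (l * (t - ψ x)) / ∫ y, Real.exp (l * (t - ψ y)) ∂(P : Measure S))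
        • (t - ψ x)) = fun x => (∫ y, Real.exp (l * (t - ψ y)) ∂(P : Measure S))⁻¹
          * ((t - ψ x) * Real.exp (l * (t - ψ x))) := by
      ext x; rw [smul_eq_mul]; ring
    rw [this, integral_const_mul, hl, mul_zero]
  have hiQ := integrable_of_abs_le hψ hC Q
  have hmean' : ∫ x, ψ x ∂Q = t := by
    rw [integral_sub (integrable_const t) hiQ] at hmean
    simp only [integral_const, probReal_univ, one_smul] at hmean
    linarith
  refine ⟨l, ⟨Q, hprob⟩, hl0, hmean', ?_⟩
  change klDiv Q (P : Measure S) ≤ _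
  have hiY : Integrable (fun x => l * (t - ψ x)) Q :=
    ((integrable_const t).sub hiQ).const_mul l
  refine (klDiv_le_of_le_withDensity_exp Q (P : Measure S)
    (g := fun x => l * (t - ψ x) - cgf (fun x => t - ψ x) (P : Measure S) l) (by fun_prop)
    (hiY.sub (integrable_const _)) (le_of_eq ?_)).trans (le_of_eq ?_)
  · rw [hQ, Measure.tilted]
    congr 1
    ext x
    rw [Real.exp_sub, cgf, Real.exp_log hmgf]
    rfl
  · rw [integral_sub hiY (integrable_const _), integral_const_mul, hmean]
    simp

theorem tendsto_mgf_const_sub_of_ae_le {ψ : S → ℝ} (hψ : Measurable ψ) {t : ℝ}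
    (P : Measure S) [IsProbabilityMeasure P] (h : ∀ᵐ x ∂P, t ≤ ψ x) :
    Tendsto (fun k : ℕ => mgf (fun x => t - ψ x) P k) atTop (𝓝 (P.real {x | ψ x = t})) := by
  have hs : MeasurableSet {x | ψ x = t} := hψ (measurableSet_singleton t)
  have : P.real {x | ψ x = t} = ∫ x, {x | ψ x = t}.indicator 1 x ∂P := by
    rw [integral_indicator_one hs]
  rw [this]
  refine tendsto_integral_of_dominated_convergence (fun _ => (1 : ℝ))
    (fun k => Measurable.aestronglyMeasurable (by fun_prop)) (integrable_const _) (fun k => ?_) ?_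
  · filter_upwards [h] with x hx
    rw [Real.norm_eq_abs, Real.abs_exp, Real.exp_le_one_iff]
    exact mul_nonpos_of_nonneg_of_nonpos (by positivity) (by linarith)
  · filter_upwards [h] with x hx
    rcases hx.eq_or_lt with he | hlt
    · rw [Set.indicator_of_mem (show x ∈ {x | ψ x = t} from he.symm)]
      simp [← he]
    · rw [Set.indicator_of_notMem (show x ∉ {x | ψ x = t} from hlt.ne')]
      refine Real.tendsto_exp_atBot.comp ?_
      exact tendsto_natCast_atTop_atTop.atTop_mul_const_of_neg (by linarith)

theorem iidLaw_sampleMean_lt_eq_zero {ψ : S → ℝ} {t : ℝ}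
    {P : ProbabilityMeasure S} (h : ∀ᵐ x ∂(P : Measure S), t ≤ ψ x) {n : ℕ} (hn : 1 ≤ n) :
    iidLaw P n {x | sampleMean ψ x < t} = 0 := by
  have hall : ∀ᵐ x ∂(iidLaw P n), ∀ i, t ≤ ψ (x i) := by
    rw [ae_all_iff]
    exact fun i => (measurePreserving_eval_iidLaw P n i).quasiMeasurePreserving.ae h
  refine measure_mono_null (fun x hx => ?_) (ae_iff.1 hall)
  intro hcon
  have h1 : ∑ _i : Fin n, t ≤ ∑ i, ψ (x i) := Finset.sum_le_sum fun i _ => hcon i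
  have h2 := (sampleMean_lt_iff hn x t).1 hx
  simp only [Finset.sum_const, Finset.card_univ, Fintype.card_fin, nsmul_eq_mul] at h1
  linarith

theorem pow_le_iidLaw_sampleMean_lt {ψ : S → ℝ} {t τ : ℝ} (P : ProbabilityMeasure S) (h : t < τ)
    {n : ℕ} (hn : 1 ≤ n) :
    (P : Measure S) {x | ψ x = t} ^ n ≤ iidLaw P n {x | sampleMean ψ x < τ} := by
  have : iidLaw P n (Set.univ.pi fun _ => {x | ψ x = t}) = (P : Measure S) {x | ψ x = t} ^ n := by
    rw [iidLaw, Measure.pi_pi]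
    simp
  rw [← this]
  refine measure_mono fun x hx => (sampleMean_lt_iff hn x τ).2 ?_
  have hn0 : (0 : ℝ) < n := by positivity
  rw [Finset.sum_congr rfl fun i _ => hx i trivial]
  simpa using mul_lt_mul_of_pos_left h hn0

/-- The exponent of the lower tail of the sample mean at a level converging to `t`. A finite
exponent is bounded below by the divergence from a measure on which `ψ` has mean `t`, or is
trivially so because the mean of `ψ` is at most `t` already. -/
theorem exists_tendsto_normalizedNegLog_iidLaw {ψ : S → ℝ} (hψ : Measurable ψ) {C : ℝ}
    (hC : ∀ x, |ψ x| ≤ C) {t : ℝ} {τ : ℕ → ℝ} (hτ : Tendsto τ atTop (𝓝 t))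
    (hτ' : (∀ n, 1 ≤ n → τ n = t) ∨ ∀ n, 1 ≤ n → t < τ n) (P : ProbabilityMeasure S) :
    ∃ L : EReal,
      Tendsto (fun n : ℕ => normalizedNegLog n (iidLaw P n {x | sampleMean ψ x < τ n})) atTop
        (𝓝 L) ∧
      (L = ⊤ ∨ ∃ Q : ProbabilityMeasure S,
        (∫ x, ψ x ∂(Q : Measure S) = t ∨ Q = P ∧ ∫ x, ψ x ∂(P : Measure S) ≤ t) ∧
        (klDiv (Q : Measure S) (P : Measure S) : EReal) ≤ L) := by
  have hle : ∀ n, 1 ≤ n → t ≤ τ n := fun n hn =>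
    hτ'.elim (fun h => (h n hn).ge) fun h => (h n hn).le
  have hnn : (0 : EReal) ≤
      liminf (fun n : ℕ => normalizedNegLog n (iidLaw P n {x | sampleMean ψ x < τ n})) atTop :=
    le_liminf_of_le (h := Eventually.of_forall fun n => normalizedNegLog_nonneg n prob_le_one)
  by_cases hpos : (P : Measure S) {x | ψ x < t} = 0
  · have hae : ∀ᵐ x ∂(P : Measure S), t ≤ ψ x := by
      rw [ae_iff]; simpa using hpos
    rcases hτ' with hτ' | hτ'
    · refine ⟨⊤, tendsto_const_nhds.congr' ?_, Or.inl rfl⟩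
      filter_upwards [eventually_ge_atTop 1] with n hn
      rw [hτ' n hn, iidLaw_sampleMean_lt_eq_zero hae hn, normalizedNegLog_zero hn]
    · have hmgf := tendsto_mgf_const_sub_of_ae_le hψ (P : Measure S) hae
      have hmpos : ∀ k : ℕ, 0 < mgf (fun x => t - ψ x) (P : Measure S) k := fun k =>
        mgf_pos (integrable_exp_mul_const_sub hψ hC t k _)
      have hcgf : ∀ k : ℕ, ((-cgf (fun x => t - ψ x) (P : Measure S) k : ℝ) : EReal) ≤ _ :=
        fun k => neg_cgf_le_liminf_iidLaw hψ hC P hτ (Nat.cast_nonneg k)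
      by_cases hp : (P : Measure S) {x | ψ x = t} = 0
      · refine ⟨⊤, ?_, Or.inl rfl⟩
        refine tendsto_of_le_liminf_of_limsup_le ?_ le_top
        rw [measureReal_def, hp, ENNReal.toReal_zero] at hmgf
        have h1 : Tendsto (fun k : ℕ => -cgf (fun x => t - ψ x) (P : Measure S) k) atTop atTop :=
          tendsto_neg_atBot_atTop.comp (Real.tendsto_log_nhdsGT_zero.comp
            (tendsto_nhdsWithin_iff.2 ⟨hmgf, Eventually.of_forall hmpos⟩))
        exact le_of_tendsto' (EReal.tendsto_coe_atTop.comp h1) hcgf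
      · have hs : MeasurableSet {x | ψ x = t} := hψ (measurableSet_singleton t)
        have hp0 : 0 < (P : Measure S).real {x | ψ x = t} :=
          ENNReal.toReal_pos hp (measure_ne_top _ _)
        have hprob := cond_isProbabilityMeasure hp
        refine ⟨((-Real.log ((P : Measure S).real {x | ψ x = t}) : ℝ) : EReal), ?_,
          Or.inr ⟨⟨_, hprob⟩, Or.inl ?_, ?_⟩⟩
        · refine tendsto_of_le_liminf_of_limsup_le ?_ ?_
          · exact le_of_tendsto' ((continuous_coe_real_ereal.tendsto _).comp
              (hmgf.log hp0.ne').neg) hcgf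
          · refine limsup_normalizedNegLog_le one_pos ?_
            filter_upwards [eventually_ge_atTop 1] with n hn
            refine le_trans (le_of_eq ?_) (pow_le_iidLaw_sampleMean_lt P (hτ' n hn) hn)
            rw [one_mul, mul_neg, neg_neg, Real.exp_nat_mul, Real.exp_log hp0,
              ENNReal.ofReal_pow hp0.le, ofReal_measureReal]
        · change ∫ x, ψ x ∂((P : Measure S)[|{x | ψ x = t}]) = t
          have : ∀ᵐ x ∂((P : Measure S)[|{x | ψ x = t}]), ψ x = t := ae_cond_mem hs
          rw [integral_congr_ae this]
          simp
        · refine (EReal.coe_ennreal_le_coe_ennreal_iff.2 (klDiv_cond_le _ hp)).trans ?_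
          rw [EReal.coe_ennreal_ofReal, max_eq_left]
          exact neg_nonneg.2 (Real.log_nonpos hp0.le measureReal_le_one)
  · have hup : ∀ Q : ProbabilityMeasure S, ∫ x, ψ x ∂(Q : Measure S) ≤ t →
        limsup (fun n : ℕ => normalizedNegLog n (iidLaw P n {x | sampleMean ψ x < τ n})) atTop
          ≤ (klDiv (Q : Measure S) (P : Measure S) : EReal) := by
      intro Q hQ
      refine le_trans (limsup_le_limsup ?_) (limsup_iidLaw_sampleMean_lt_le_klDiv hψ hC hpos hQ)
      filter_upwards [eventually_ge_atTop 1] with n hn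
      exact normalizedNegLog_anti n (measure_mono fun x hx => lt_of_lt_of_le hx (hle n hn))
    rcases le_or_gt (∫ x, ψ x ∂(P : Measure S)) t with hE | hE
    · refine ⟨0, tendsto_of_le_liminf_of_limsup_le hnn ?_, Or.inr ⟨P, Or.inr ⟨rfl, hE⟩, ?_⟩⟩
      · simpa using hup P hE
      · simp
    · obtain ⟨l, Q, hl, hQt, hQ⟩ := exists_integral_eq_klDiv_le_neg_cgf hψ hC hpos hE
      refine ⟨(klDiv (Q : Measure S) (P : Measure S) : EReal),
        tendsto_of_le_liminf_of_limsup_le ?_ (hup Q hQt.le), Or.inr ⟨Q, Or.inl hQt, le_rfl⟩⟩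
      refine (EReal.coe_ennreal_le_coe_ennreal_iff.2 hQ).trans ?_
      rw [EReal.coe_ennreal_ofReal]
      rcases max_cases (-cgf (fun x => t - ψ x) (P : Measure S) l) 0 with ⟨e, _⟩ | ⟨e, _⟩
      · rw [e]
        exact neg_cgf_le_liminf_iidLaw hψ hC P hτ hl
      · rw [e]
        exact hnn

end Limit

section Test

variable {S : Type*} [MeasurableSpace S]

open ProbabilityTheory InformationTheory

/-- Hoeffding's inequality for the sample mean. -/
theorem iidLaw_le_sampleMean_le_exp [Nonempty S] {ψ : S → ℝ} (hψ : Measurable ψ) {c : ℝ}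
    (hc0 : 0 < c) (hc : ∀ x y, |ψ x - ψ y| ≤ c) (P : ProbabilityMeasure S) {t r : ℝ}
    (ht : ∫ x, ψ x ∂(P : Measure S) ≤ t) (hr : 0 ≤ r) {n : ℕ} (hn : 1 ≤ n) :
    iidLaw P n {x | t + r ≤ sampleMean ψ x}
      ≤ ENNReal.ofReal (Real.exp (-(2 * n * r ^ 2 / c ^ 2))) := by
  have hn0 : (0 : ℝ) < n := by positivity
  obtain ⟨x₀⟩ := ‹Nonempty S›
  have hbdd : BddBelow (Set.range ψ) := by
    refine ⟨ψ x₀ - c, ?_⟩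
    rintro _ ⟨x, rfl⟩
    linarith [(abs_le.1 (hc x₀ x)).2]
  set a := ⨅ x, ψ x with ha
  have hmem : ∀ x, ψ x ∈ Set.Icc a (a + c) := by
    refine fun x => ⟨ciInf_le hbdd x, ?_⟩
    have : Nonempty S := ⟨x₀⟩
    have : ψ x - c ≤ a := le_ciInf fun y => by linarith [(abs_le.1 (hc x y)).2]
    linarith
  have hsub := hasSubgaussianMGF_of_mem_Icc (μ := (P : Measure S)) hψ.aemeasurable
    (ae_of_all _ hmem)
  set m := ∫ x, ψ x ∂(P : Measure S) with hm
  have hsub' : ∀ i : Fin n, HasSubgaussianMGF (fun x : Fin n → S => ψ (x i) - m)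
      ((‖a + c - a‖₊ / 2) ^ 2) (iidLaw P n) := by
    intro i
    refine HasSubgaussianMGF.of_map (Y := fun x : Fin n → S => x i)
      (measurable_pi_apply i).aemeasurable (X := fun x => ψ x - m) ?_
    rw [(measurePreserving_eval_iidLaw P n i).map_eq]
    exact hsub
  have hH := HasSubgaussianMGF.measure_sum_ge_le_of_iIndepFun (s := Finset.univ)
    (iIndepFun_iidLaw P n (g := fun x => ψ x - m) (by fun_prop)) (fun i _ => hsub' i)
    (ε := n * r) (by positivity)
  have hset : {x : Fin n → S | t + r ≤ sampleMean ψ x}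
      ⊆ {x | n * r ≤ ∑ i, (ψ (x i) - m)} := by
    intro x hx
    have h1 := (le_sampleMean_iff hn x (t + r)).1 hx
    have h2 : (n : ℝ) * m ≤ n * t := mul_le_mul_of_nonneg_left ht hn0.le
    simp only [Set.mem_ofPred_eq, Finset.sum_sub_distrib, Finset.sum_const,
      Finset.card_univ, Fintype.card_fin, nsmul_eq_mul]
    linarith
  refine (measure_mono hset).trans ?_
  rw [← ofReal_measureReal]
  refine ENNReal.ofReal_le_ofReal (hH.trans (le_of_eq ?_))
  congr 1
  simp only [Finset.sum_const, Finset.card_univ, Fintype.card_fin, nsmul_eq_mul, NNReal.coe_mul,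
    NNReal.coe_natCast, NNReal.coe_pow, NNReal.coe_div, coe_nnnorm, NNReal.coe_ofNat,
    add_sub_cancel_left, Real.norm_eq_abs, abs_of_pos hc0]
  field_simp

theorem lintegral_thresholdTest_prob {ψ : S → ℝ} (hψ : Measurable ψ) (τ : ℕ → ℝ) (n : ℕ)
    (μ : Measure (Fin n → S)) :
    ∫⁻ x, ENNReal.ofReal ((thresholdTest ψ hψ τ).prob n x) ∂μ
      = μ {x | τ n ≤ sampleMean ψ x} := by
  rw [← lintegral_indicator_one (measurableSet_le measurable_const (measurable_sampleMean hψ n))]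
  refine lintegral_congr fun x => ?_
  by_cases h : τ n ≤ sampleMean ψ x <;> simp [thresholdTest, h]

theorem typeII_thresholdTest {ψ : S → ℝ} (hψ : Measurable ψ) (τ : ℕ → ℝ)
    (P : ProbabilityMeasure S) (n : ℕ) :
    (thresholdTest ψ hψ τ).typeII P n = iidLaw P n {x | sampleMean ψ x < τ n} := by
  rw [BatchTest.typeII,
    ← lintegral_indicator_one (measurableSet_lt (measurable_sampleMean hψ n) measurable_const)]
  refine lintegral_congr fun x => ?_
  by_cases h : τ n ≤ sampleMean ψ x
  · simp [thresholdTest, h]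
  · simp [thresholdTest, h, not_le.1 h]

theorem worstTypeI_thresholdTest {ψ : S → ℝ} (hψ : Measurable ψ) (τ : ℕ → ℝ)
    (A : Set (ProbabilityMeasure S)) (n : ℕ) :
    (thresholdTest ψ hψ τ).worstTypeI A n
      = ⨆ P₀ ∈ A, iidLaw P₀ n {x | τ n ≤ sampleMean ψ x} := by
  simp only [BatchTest.worstTypeI, lintegral_thresholdTest_prob]

theorem le_infKL {A B : Set (ProbabilityMeasure S)} {x : EReal}
    (h : ∀ P₀ ∈ A, ∀ P₁ ∈ B, x ≤ (klDiv (P₀ : Measure S) (P₁ : Measure S) : EReal)) :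
    x ≤ (infKL A B : EReal) := by
  refine le_trans ?_ ((EReal.coe_ennreal_le_coe_ennreal_iff (x := x.toENNReal)).2 ?_)
  · exact EReal.coe_toENNReal_eq_max ▸ le_max_right _ _
  refine le_iInf₂ fun P₀ h₀ => le_iInf₂ fun P₁ h₁ => ?_
  simpa using EReal.toENNReal_le_toENNReal (h P₀ h₀ P₁ h₁)

theorem infKL_le {A B : Set (ProbabilityMeasure S)} {P₀ P₁ : ProbabilityMeasure S}
    (h₀ : P₀ ∈ A) (h₁ : P₁ ∈ B) : infKL A B ≤ klDiv (P₀ : Measure S) (P₁ : Measure S) :=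
  (iInf₂_le P₀ h₀).trans (iInf₂_le P₁ h₁)

theorem neymanPearsonValue_le_infKL (A B : Set (ProbabilityMeasure S)) {α : ℝ} (hα₀ : 0 ≤ α)
    (hα : α < 1) : neymanPearsonValue A B α ≤ (infKL A B : EReal) := by
  refine iSup₂_le fun φ hφ => le_infKL fun P₀ h₀ P₁ h₁ => (iInf₂_le P₁ h₁).trans ?_
  have hm := φ.measurable_prob
  refine limsup_normalizedNegLog_lintegral_le_klDiv P₀ P₁
    (fun n x => ENNReal.ofReal (1 - φ.prob n x))
    (fun n => ENNReal.measurable_ofReal.comp (measurable_const.sub (hm n)))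
    (fun n x => ENNReal.ofReal_le_one.2 (by linarith [(φ.prob_mem n x).1])) (β := 1 - α)
    (by linarith) ?_
  filter_upwards [eventually_ge_atTop 1] with n hn
  have h1 : ∫⁻ x, ENNReal.ofReal (φ.prob n x) ∂(iidLaw P₀ n) ≤ ENNReal.ofReal α :=
    (le_iSup₂ (f := fun P (_ : P ∈ A) => ∫⁻ x, ENNReal.ofReal (φ.prob n x) ∂(iidLaw P n))
      P₀ h₀).trans (hφ n hn)
  have h2 : ∫⁻ x, ENNReal.ofReal (φ.prob n x) ∂(iidLaw P₀ n)
      + ∫⁻ x, ENNReal.ofReal (1 - φ.prob n x) ∂(iidLaw P₀ n) = 1 := by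
    rw [← lintegral_add_left (f := fun x => ENNReal.ofReal (φ.prob n x))
      (ENNReal.measurable_ofReal.comp (hm n))]
    have : ∀ x, ENNReal.ofReal (φ.prob n x) + ENNReal.ofReal (1 - φ.prob n x) = 1 := by
      intro x
      rw [← ENNReal.ofReal_add (φ.prob_mem n x).1 (by linarith [(φ.prob_mem n x).2])]
      simp
    simp [this]
  rw [ENNReal.ofReal_sub _ hα₀, ENNReal.ofReal_one, ← h2, tsub_le_iff_left]
  gcongr

/-- The lower tail exponents of the sample mean at a level converging to `t`, and their infimum
over a set `B` that is star-shaped about some `R` charging `{ψ < t}`. -/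
theorem exists_tendsto_iInf_eq_infKL {ψ : S → ℝ} (hψ : Measurable ψ) {C : ℝ}
    (hC : ∀ x, |ψ x| ≤ C) {t : ℝ} {τ : ℕ → ℝ} (hτ : Tendsto τ atTop (𝓝 t))
    (hτ' : (∀ n, 1 ≤ n → τ n = t) ∨ ∀ n, 1 ≤ n → t < τ n) {A B : Set (ProbabilityMeasure S)}
    (hA : ∀ P ∈ A, ∫ x, ψ x ∂(P : Measure S) ≤ t)
    (hAt : ∀ P : ProbabilityMeasure S, ∫ x, ψ x ∂(P : Measure S) = t → P ∈ A)
    (hBA : ∀ P ∈ B, ∫ x, ψ x ∂(P : Measure S) ≤ t → P ∈ A)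
    {R : ProbabilityMeasure S} (hR : (R : Measure S) {x | ψ x < t} ≠ 0)
    (hB : ∀ P ∈ B, ∀ (Q : ProbabilityMeasure S) (a b : ℝ), 0 ≤ a → 0 ≤ b → a + b = 1 →
      (Q : Measure S) = ENNReal.ofReal a • (P : Measure S) + ENNReal.ofReal b • (R : Measure S) →
      Q ∈ B) :
    ∃ L : ProbabilityMeasure S → EReal,
      (∀ P, Tendsto (fun n : ℕ => normalizedNegLog n (iidLaw P n {x | sampleMean ψ x < τ n})) atTop
        (𝓝 (L P))) ∧ ⨅ P ∈ B, L P = (infKL A B : EReal) := by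
  choose L hL hL' using exists_tendsto_normalizedNegLog_iidLaw hψ hC hτ hτ'
  refine ⟨L, hL, le_antisymm (le_infKL fun P₀ h₀ P₁ h₁ => ?_) (le_iInf₂ fun P hP => ?_)⟩
  · by_cases hfin : klDiv (P₀ : Measure S) (P₁ : Measure S) = ⊤
    · simp [hfin]
    rw [← ENNReal.ofReal_toReal hfin, EReal.coe_ennreal_ofReal, max_eq_left ENNReal.toReal_nonneg]
    refine le_coe_of_forall_pos_le_coe_add fun ε hε => ?_
    have ha1 : Real.exp (-ε) < 1 := by simpa using hε
    have ha0 : 0 < Real.exp (-ε) := Real.exp_pos _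
    obtain ⟨Q, hQ⟩ := exists_convexCombination P₁ R ha0.le (b := 1 - Real.exp (-ε)) (by linarith)
      (by ring)
    have hQB := hB P₁ h₁ Q _ _ ha0.le (by linarith) (by ring) hQ
    have hQpos : (Q : Measure S) {x | ψ x < t} ≠ 0 := by
      rw [hQ, Measure.add_apply, Measure.smul_apply, Measure.smul_apply, smul_eq_mul, smul_eq_mul]
      have : ENNReal.ofReal (1 - Real.exp (-ε)) * (R : Measure S) {x | ψ x < t} ≠ 0 :=
        mul_ne_zero (by simpa using hε) hR
      exact fun h => this (add_eq_zero.1 h).2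
    have hdom : (P₁ : Measure S) ≤ ENNReal.ofReal (Real.exp ε) • (Q : Measure S) := by
      rw [hQ, smul_add, smul_smul, ← ENNReal.ofReal_mul (Real.exp_pos _).le, ← Real.exp_add]
      simp only [add_neg_cancel, Real.exp_zero, ENNReal.ofReal_one, one_smul]
      exact Measure.le_add_right le_rfl
    have hkl := klDiv_le_add_log_of_le_smul (P₀ : Measure S) (P₁ : Measure S) (Q : Measure S)
      (Real.exp_pos ε) hdom hfin
    rw [Real.log_exp] at hkl
    refine (iInf₂_le Q hQB).trans ?_
    have hlim : L Q ≤ (klDiv (P₀ : Measure S) (Q : Measure S) : EReal) := by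
      rw [← (hL Q).limsup_eq]
      refine le_trans (limsup_le_limsup ?_)
        (limsup_iidLaw_sampleMean_lt_le_klDiv hψ hC hQpos (hA P₀ h₀))
      filter_upwards [eventually_ge_atTop 1] with n hn
      refine normalizedNegLog_anti n (measure_mono fun x hx => lt_of_lt_of_le hx
        (hτ'.elim (fun h => (h n hn).ge) fun h => (h n hn).le))
    refine hlim.trans ((EReal.coe_ennreal_le_coe_ennreal_iff.2 hkl).trans (le_of_eq ?_))
    rw [EReal.coe_ennreal_ofReal, max_eq_left]
    have : 0 ≤ (klDiv (P₀ : Measure S) (P₁ : Measure S)).toReal := ENNReal.toReal_nonneg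
    positivity
  · rcases hL' P with h | ⟨Q, hQ, hQL⟩
    · rw [h]; exact le_top
    · refine le_trans (EReal.coe_ennreal_le_coe_ennreal_iff.2 (infKL_le ?_ hP)) hQL
      rcases hQ with hQ | ⟨rfl, hQ⟩
      · exact hAt Q hQ
      · exact hBA Q hP hQ

theorem isProbabilityMeasure_empiricalMeasure {m : ℕ} (hm : 0 < m) (x : Fin m → S) :
    IsProbabilityMeasure (empiricalMeasure x) := by
  constructor
  simp only [empiricalMeasure, Measure.smul_apply, Measure.coe_finsetSum, Finset.sum_apply,
    measure_univ, Finset.sum_const, Finset.card_univ, Fintype.card_fin, nsmul_eq_mul, mul_one,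
    smul_eq_mul]
  exact ENNReal.inv_mul_cancel (by exact_mod_cast hm.ne') (ENNReal.natCast_ne_top m)

end Test

theorem thresholdTest_robust_neymanPearson {S : Type*} [MeasurableSpace S] [Nonempty S]
    {ψ : S → ℝ} (hψ : Measurable ψ) {c : ℝ} (hc0 : 0 < c) (hc : ∀ x y, |ψ x - ψ y| ≤ c)
    {t α : ℝ} (hα₀ : 0 < α) (hα₁ : α ≤ 1) {γ : ℕ → ℝ}
    (hγ : ∀ n : ℕ, γ n = √(-c ^ 2 * Real.log α / (2 * n))) {A B : Set (ProbabilityMeasure S)}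
    (hA : ∀ P ∈ A, ∫ x, ψ x ∂(P : Measure S) ≤ t)
    (hAt : ∀ P : ProbabilityMeasure S, ∫ x, ψ x ∂(P : Measure S) = t → P ∈ A)
    (hBA : ∀ P ∈ B, ∫ x, ψ x ∂(P : Measure S) ≤ t → P ∈ A)
    {R : ProbabilityMeasure S} (hR : (R : Measure S) {x | ψ x < t} ≠ 0)
    (hB : ∀ P ∈ B, ∀ (Q : ProbabilityMeasure S) (a b : ℝ), 0 ≤ a → 0 ≤ b → a + b = 1 →
      (Q : Measure S) = ENNReal.ofReal a • (P : Measure S) + ENNReal.ofReal b • (R : Measure S) →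
      Q ∈ B) :
    (∀ n : ℕ, 1 ≤ n →
      (thresholdTest ψ hψ fun n => t + γ n).worstTypeI A n
          = ⨆ P₀ ∈ A, iidLaw P₀ n {x | t + γ n ≤ sampleMean ψ x} ∧
      (thresholdTest ψ hψ fun n => t + γ n).worstTypeI A n ≤ ENNReal.ofReal α) ∧
    (∃ L : ProbabilityMeasure S → EReal,
      (∀ P₁ ∈ B,
        Tendsto (fun n : ℕ => normalizedNegLog n
          ((thresholdTest ψ hψ fun n => t + γ n).typeII P₁ n)) atTop (𝓝 (L P₁)) ∧
        Tendsto (fun n : ℕ => normalizedNegLog n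
          (iidLaw P₁ n {x | sampleMean ψ x < t + γ n})) atTop (𝓝 (L P₁))) ∧
      ⨅ P₁ ∈ B, L P₁ = (infKL A B : EReal)) ∧
    (α < 1 → (thresholdTest ψ hψ fun n => t + γ n).worstExponent B
      = neymanPearsonValue A B α) := by
  obtain ⟨x₀⟩ := ‹Nonempty S›
  have hC : ∀ x, |ψ x| ≤ |ψ x₀| + c := fun x => by
    have h1 := abs_sub_abs_le_abs_sub (ψ x) (ψ x₀)
    linarith [hc x x₀]
  have hlog : 0 ≤ -c ^ 2 * Real.log α := by
    have := Real.log_nonpos hα₀.le hα₁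
    nlinarith [sq_nonneg c]
  have hγt : Tendsto (fun n => t + γ n) atTop (𝓝 t) := by
    have h1 : Tendsto (fun n : ℕ => -c ^ 2 * Real.log α / 2 / (n : ℝ)) atTop (𝓝 0) :=
      tendsto_const_div_atTop_nhds_zero_nat _
    have h2 := (Real.continuous_sqrt.tendsto 0).comp h1
    rw [Real.sqrt_zero] at h2
    have h3 : γ = Real.sqrt ∘ fun n : ℕ => -c ^ 2 * Real.log α / 2 / (n : ℝ) := by
      ext n
      rw [hγ n, Function.comp_apply, div_div]
    have := (h3 ▸ h2).const_add t
    simpa using this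
  have hγ' : (∀ n, 1 ≤ n → t + γ n = t) ∨ ∀ n, 1 ≤ n → t < t + γ n := by
    rcases hα₁.eq_or_lt with rfl | h
    · left
      intro n _
      simp [hγ n]
    · right
      intro n hn
      have hn0 : (0 : ℝ) < n := by positivity
      have h1 : 0 < -c ^ 2 * Real.log α := by
        have := Real.log_neg hα₀ h
        have := mul_pos (pow_pos hc0 2) (neg_pos.2 this)
        linarith
      rw [hγ n]
      have : 0 < √(-c ^ 2 * Real.log α / (2 * n)) := Real.sqrt_pos.2 (by positivity)
      linarith
  have hI : ∀ n : ℕ, 1 ≤ n →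
      (thresholdTest ψ hψ fun n => t + γ n).worstTypeI A n ≤ ENNReal.ofReal α := by
    intro n hn
    have hn0 : (0 : ℝ) < n := by positivity
    rw [worstTypeI_thresholdTest]
    refine iSup₂_le fun P hP => ?_
    have : Nonempty S := ⟨x₀⟩
    refine (iidLaw_le_sampleMean_le_exp hψ hc0 hc P (hA P hP)
      (by rw [hγ n]; exact Real.sqrt_nonneg _) hn).trans (le_of_eq ?_)
    rw [hγ n, Real.sq_sqrt (by positivity)]
    have : -(2 * n * (-c ^ 2 * Real.log α / (2 * n)) / c ^ 2) = Real.log α := by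
      field_simp
    rw [this, Real.exp_log hα₀]
  obtain ⟨L, hL, hLinf⟩ := exists_tendsto_iInf_eq_infKL hψ hC hγt hγ' hA hAt hBA hR hB
  refine ⟨fun n hn => ⟨worstTypeI_thresholdTest _ _ _ _, hI n hn⟩, ⟨L, fun P _ => ?_, hLinf⟩,
    fun hα => ?_⟩
  · simp only [typeII_thresholdTest]
    exact ⟨hL P, hL P⟩
  · refine le_antisymm (le_iSup₂ (f := fun φ _ => BatchTest.worstExponent φ B) _ hI)
      ((neymanPearsonValue_le_infKL A B hα₀.le hα).trans (le_of_eq ?_))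
    rw [← hLinf, BatchTest.worstExponent]
    simp only [typeII_thresholdTest, fun P => (hL P).limsup_eq]

theorem pos_of_integral_lt_integral {S : Type*} [MeasurableSpace S] {ψ : S → ℝ}
    (P Q : ProbabilityMeasure S) (h : ∫ x, ψ x ∂(P : Measure S) < ∫ x, ψ x ∂(Q : Measure S))
    {c : ℝ} (hc : ∀ x y, |ψ x - ψ y| ≤ c) : 0 < c := by
  by_contra! hcon
  obtain ⟨x₀⟩ := nonempty_of_isProbabilityMeasure (P : Measure S)
  have : ψ = fun _ => ψ x₀ := funext fun x =>
    sub_eq_zero.1 (abs_nonpos_iff.1 ((hc x x₀).trans hcon))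
  rw [this] at h
  simp at h

theorem theorem9 {d m₀ m₁ : ℕ} (hm₀ : 0 < m₀) (hm₁ : 0 < m₁)
    (X : Set (EuclideanSpace ℝ (Fin d))) (hX : IsCompact X)
    (xhat₀ : Fin m₀ → X) (xhat₁ : Fin m₁ → X)
    (ψ₀ : X → ℝ) (hψ₀ : Continuous ψ₀)
    (q₀ q₁ : ℝ)
    (hq₀ : q₀ = ∫ x, ψ₀ x ∂(empiricalMeasure xhat₀))
    (hq₁ : q₁ = ∫ x, ψ₀ x ∂(empiricalMeasure xhat₁))
    (η : ℝ) (hη : 0 < η) (hsep : η < (q₁ - q₀) / 2)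
    (U : ℝ → Set (ProbabilityMeasure X))
    (hU : U = momentSet ψ₀ η ∨ U = oneSidedMomentSet ψ₀ η)
    (α : ℝ) (hα₀ : 0 < α) (hα₁ : α ≤ 1)
    (c : ℝ) (hc : ∀ x y : X, |ψ₀ x - ψ₀ y| ≤ c)
    (γ : ℕ → ℝ) (hγ : ∀ n : ℕ, γ n = √(-c ^ 2 * Real.log α / (2 * n)))
    (φ : BatchTest X)
    (hφ : φ = thresholdTest ψ₀ hψ₀.measurable (fun n => q₀ + η + γ n)) :
    -- under `H₀`
    (∀ n : ℕ, 1 ≤ n →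
      φ.worstTypeI (U q₀) n
          = ⨆ P₀ ∈ U q₀, iidLaw P₀ n {x | q₀ + η + γ n ≤ sampleMean ψ₀ x} ∧
      φ.worstTypeI (U q₀) n ≤ ENNReal.ofReal α) ∧
    -- under `H₁`: all the limits exist in `[-∞, ∞]`, and their infimum is the divergence
    (∃ L : ProbabilityMeasure X → EReal,
      (∀ P₁ ∈ U q₁,
        Tendsto (fun n : ℕ => normalizedNegLog n (φ.typeII P₁ n)) atTop (𝓝 (L P₁)) ∧
        Tendsto (fun n : ℕ => normalizedNegLog n
          (iidLaw P₁ n {x | sampleMean ψ₀ x < q₀ + η + γ n})) atTop (𝓝 (L P₁))) ∧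
      ⨅ P₁ ∈ U q₁, L P₁ = (infKL (U q₀) (U q₁) : EReal)) ∧
    -- asymptotic optimality
    (α < 1 → φ.worstExponent (U q₁) = neymanPearsonValue (U q₀) (U q₁) α) := by
  subst hφ
  have hψ := hψ₀.measurable
  let E₀ : ProbabilityMeasure X := ⟨_, isProbabilityMeasure_empiricalMeasure hm₀ xhat₀⟩
  let E₁ : ProbabilityMeasure X := ⟨_, isProbabilityMeasure_empiricalMeasure hm₁ xhat₁⟩
  have hE₀ : ∫ x, ψ₀ x ∂(E₀ : Measure X) = q₀ := hq₀.symm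
  have hE₁ : ∫ x, ψ₀ x ∂(E₁ : Measure X) = q₁ := hq₁.symm
  have hgap : 0 < q₁ - q₀ := by linarith
  have hc0 : 0 < c := pos_of_integral_lt_integral E₀ E₁ (by linarith) hc
  have : Nonempty X := ⟨xhat₀ ⟨0, hm₀⟩⟩
  obtain ⟨C, hC⟩ : ∃ C, ∀ x, |ψ₀ x| ≤ C :=
    ⟨|ψ₀ (xhat₀ ⟨0, hm₀⟩)| + c, fun x => by
      linarith [abs_sub_abs_le_abs_sub (ψ₀ x) (ψ₀ (xhat₀ ⟨0, hm₀⟩)), hc x (xhat₀ ⟨0, hm₀⟩)]⟩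
  set b := η / (q₁ - q₀) with hb
  have hb0 : 0 < b := by positivity
  have hb1 : b < 1 := by rw [hb, div_lt_one hgap]; linarith
  have hbgap : b * (q₁ - q₀) = η := by rw [hb]; field_simp
  obtain ⟨R, hR⟩ := exists_convexCombination E₁ E₀ (a := 1 - b) (b := b) (by linarith) hb0.le
    (by ring)
  have hRint : ∫ x, ψ₀ x ∂(R : Measure X) = q₁ - η := by
    rw [integral_convexCombination hψ hC (by linarith) hb0.le hR, hE₀, hE₁]
    linarith
  have hRpos : (R : Measure X) {x | ψ₀ x < q₀ + η} ≠ 0 := by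
    have h0 : (E₀ : Measure X) {x | ψ₀ x < q₀ + η} ≠ 0 := by
      intro h
      have hae : ∀ᵐ x ∂(E₀ : Measure X), q₀ + η ≤ ψ₀ x := by
        rw [ae_iff]; simpa using h
      have := integral_mono_ae (integrable_const (q₀ + η))
        (integrable_of_abs_le hψ hC (E₀ : Measure X)) hae
      rw [hE₀] at this
      simp only [integral_const, probReal_univ, one_smul] at this
      linarith
    rw [hR, Measure.add_apply, Measure.smul_apply, Measure.smul_apply, smul_eq_mul, smul_eq_mul]
    have : ENNReal.ofReal b * (E₀ : Measure X) {x | ψ₀ x < q₀ + η} ≠ 0 :=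
      mul_ne_zero (by simpa using hb0) h0
    exact fun h => this (add_eq_zero.1 h).2
  rcases hU with rfl | rfl
  · refine thresholdTest_robust_neymanPearson hψ hc0 hc hα₀ hα₁ hγ (fun P hP => ?_)
      (fun P hP => ?_) (fun P hP hPt => ?_) hRpos fun P hP Q a b ha hb hab hQ => ?_
    · have := (abs_le.1 (show |(∫ x, ψ₀ x ∂(P : Measure X)) - q₀| ≤ η from hP)).2
      linarith
    · change |(∫ x, ψ₀ x ∂(P : Measure X)) - q₀| ≤ η
      rw [hP, add_sub_cancel_left, abs_of_pos hη]
    · have := (abs_le.1 (show |(∫ x, ψ₀ x ∂(P : Measure X)) - q₁| ≤ η from hP)).1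
      linarith
    · have hP' := abs_le.1 (show |(∫ x, ψ₀ x ∂(P : Measure X)) - q₁| ≤ η from hP)
      change |(∫ x, ψ₀ x ∂(Q : Measure X)) - q₁| ≤ η
      rw [integral_convexCombination hψ hC ha hb hQ, hRint, abs_le]
      obtain rfl : a = 1 - b := by linarith
      constructor <;> nlinarith
  · refine thresholdTest_robust_neymanPearson hψ hc0 hc hα₀ hα₁ hγ (fun P hP => ?_)
      (fun P hP => ?_) (fun P hP hPt => ?_) hRpos fun P hP Q a b ha hb hab hQ => ?_
    · have : (∫ x, ψ₀ x ∂(P : Measure X)) - q₀ ≤ η := hP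
      linarith
    · change (∫ x, ψ₀ x ∂(P : Measure X)) - q₀ ≤ η
      linarith
    · change (∫ x, ψ₀ x ∂(P : Measure X)) - q₀ ≤ η
      linarith
    · have hP' : (∫ x, ψ₀ x ∂(P : Measure X)) - q₁ ≤ η := hP
      change (∫ x, ψ₀ x ∂(Q : Measure X)) - q₁ ≤ η
      rw [integral_convexCombination hψ hC ha hb hQ, hRint]
      obtain rfl : a = 1 - b := by linarith
      nlinarith
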